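/- Work in the ring of formal power series over $\mathbb{R}$ in countably many variables $x_1,x_2,\dots$, and let $\hat\Lambda$ be the completed ring of symmetric functions, i.e. all (possibly infinite) formal sums $\sum_\lambda c_\lambda s_\lambda$ of Schur functions with real coefficients $c_\lambda$, where $\lambda$ runs over all Young diagrams. Let $\omega:\hat\Lambda\to\hat\Lambda$ be the involution $\omega\bigl(\sum_\lambda c_\lambda s_\lambda\bigr)=\sum_\lambda c_\lambda s_{\lambda'}$, where $\lambda'$ is the transpose of $\lambda$. For a formal power series $p(x)\in\mathbb{R}[[x]]$ with $p(0)=1$ put $$\kappa_p=\frac{\prod_{i} p(x_i)}{\prod_{i<j}(1-x_ix_j)} .$$ Call $p$ $\kappa$-positive if $\kappa_p\in\hat\Lambda$ has only nonnegative coefficients in its expansion in Schur functions, and call $p$ and $q$ (both with constant term $1$) dual if $\kappa_p=\omega\kappa_q$. Proposition. The map $$p(x)\longmapsto p^*(x)=\frac{1}{(1-x^2)\,p(-x)}$$ is an involution on the set of $p\in\mathbb{R}[[x]]$ with $p(0)=1$, and it preserves $\kappa$-positivity: if $p$ is $\kappa$-positive, then so is $p^*$. It corresponds to applying $\omega$: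 for every $p$ with $p(0)=1$ one has $\kappa_p\in\hat\Lambda$ and $\omega\kappa_p=\kappa_{p^*}$, and $p^*$ is the only series with constant term $1$ that is dual to $p$. In particular, $1^*=1/(1-x^2)$ and $(1/(1-x^2))^*=1$, so $1$ and $1/(1-x^2)$ are dual to each other; and $(1/(1-x))^*=1/(1-x)$, so $1/(1-x)$ is self-dual. -/

import Mathlib

/-! Schur functions, the completed ring of symmetric functions and the series `κ_p`. -/

namespace KappaPositivity

section

open scoped MvPowerSeries.WithPiTopology

/-- Formal power series with real coefficients in the countably many variables `x₀, x₁, x₂, …`.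
The completed ring of symmetric functions sits inside this ring. -/
abbrev Series : Type := MvPowerSeries ℕ ℝ

/-- The semistandard tableau `T` has content `d`: each number `k` occurs exactly `d k` times as
the entry of a cell. -/
def HasContent {lam : YoungDiagram} (T : SemistandardYoungTableau lam) (d : ℕ →₀ ℕ) : Prop :=
  ∀ k : ℕ, (lam.cells.filter fun c => T c.1 c.2 = k).card = d k

/-- The Kostka number: how many semistandard tableaux of shape `lam` have content `d`. -/
noncomputable def kostka (lam : YoungDiagram) (d : ℕ →₀ ℕ) : ℕ :=
  {T : SemistandardYoungTableau lam | HasContent T d}.ncard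

/-- The Schur function `s_lam = ∑_T x^T`, the sum over all semistandard tableaux of shape `lam`. -/
noncomputable def schur (lam : YoungDiagram) : Series :=
  fun d => (kostka lam d : ℝ)

/-- `f = ∑_lam c_lam s_lam`, a possibly infinite formal sum (it converges coefficientwise). -/
def HasSchurExpansion (f : Series) (c : YoungDiagram → ℝ) : Prop :=
  HasSum (fun lam => c lam • schur lam) f

/-- The completion of the ring of symmetric functions: all formal infinite sums of
Schur functions. -/
def completedSymmetricFunctions : Set Series :=
  {f | ∃ c : YoungDiagram → ℝ, HasSchurExpansion f c}

/-- `f` is `s`-positive: in the completed ring of symmetric functions, with nonnegative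
Schur coefficients. -/
def SchurPositive (f : Series) : Prop :=
  ∃ c : YoungDiagram → ℝ, HasSchurExpansion f c ∧ ∀ lam, 0 ≤ c lam

open Classical in
/-- The involution `ω`, which takes `∑ c_lam s_lam` to `∑ c_lam s_{lam'}`, with `lam'` the
transposed diagram. (The value `0` outside the completed ring of symmetric functions is
immaterial; that `ω` is well defined is `HasSchurExpansion.unique` below.) -/
noncomputable def omega (f : Series) : Series :=
  if h : ∃ c : YoungDiagram → ℝ, HasSchurExpansion f c then
    ∑' lam : YoungDiagram, h.choose lam • schur lam.transpose
  else 0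

/-- `κ_p = ∏_i p(x_i) / ∏_{i<j} (1 - x_i x_j)`, for a series `p` with `p(0) = 1`. -/
noncomputable def kappa (p : PowerSeries ℝ) : Series :=
  (∏' i : ℕ, p.subst (MvPowerSeries.X i : Series)) *
    (∏' j : ℕ, ∏ i ∈ Finset.range j, (1 - MvPowerSeries.X i * MvPowerSeries.X j : Series))⁻¹

/-- `p` is `κ`-positive: the symmetric function `κ_p` is `s`-positive. -/
def KappaPositive (p : PowerSeries ℝ) : Prop :=
  SchurPositive (kappa p)

/-- `p` and `q` are dual: `κ_p = ω κ_q`. -/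
def IsDual (p q : PowerSeries ℝ) : Prop :=
  kappa p = omega (kappa q)

/-- The series `1 / ((1 - x²) p(-x))`. -/
noncomputable def dualSeries (p : PowerSeries ℝ) : PowerSeries ℝ :=
  ((1 - PowerSeries.X ^ 2) * PowerSeries.rescale (-1) p)⁻¹

/-! The definitions make sense: Kostka numbers count finite sets, the infinite products and the
sums of Schur functions converge, and Schur coefficients are unique. -/

theorem row_le_entry {lam : YoungDiagram} (T : SemistandardYoungTableau lam) (i j : ℕ)
    (h : (i, j) ∈ lam) : i ≤ T i j := by
  induction i with
  | zero => exact Nat.zero_le _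
  | succ i ih =>
    have h1 : (i, j) ∈ lam := lam.up_left_mem (Nat.le_succ i) le_rfl h
    exact (ih h1).trans_lt (T.col_strict (Nat.lt_succ_self i) h)

theorem finite_hasContent (lam : YoungDiagram) (d : ℕ →₀ ℕ) :
    {T : SemistandardYoungTableau lam | HasContent T d}.Finite := by
  classical
  let F : SemistandardYoungTableau lam → (ℕ × ℕ → ℕ) := fun T c => T c.1 c.2
  have hF : Function.Injective F := by
    intro T T' h
    ext i j
    exact congrFun h (i, j)
  refine Set.Finite.of_finite_image (f := F) ?_ hF.injOn
  have hfin : (Finset.image (fun g : (∀ c ∈ lam.cells, ℕ) => fun c : ℕ × ℕ =>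
      if h : c ∈ lam.cells then g c h else 0)
      (lam.cells.pi fun _ => d.support) : Set (ℕ × ℕ → ℕ)).Finite := Finset.finite_toSet _
  refine hfin.subset ?_
  rintro _ ⟨T, hT, rfl⟩
  simp only [Finset.coe_image, Set.mem_image, Finset.mem_coe, Finset.mem_pi]
  refine ⟨fun c _ => T c.1 c.2, ?_, ?_⟩
  · intro c hc
    rw [Finsupp.mem_support_iff, ← hT (T c.1 c.2)]
    exact (Finset.card_pos.mpr ⟨c, by simp [hc]⟩).ne'
  · funext c
    by_cases hc : c ∈ lam.cells
    · simp [F, hc]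
    · simp only [F, hc, dif_neg, not_false_eq_true]
      exact (T.zeros (i := c.1) (j := c.2) (by simpa using hc)).symm

/-- The content of the tableau of shape `mu` whose `i`-th row is filled with `i`. -/
noncomputable def rowContent (mu : YoungDiagram) : ℕ →₀ ℕ :=
  Finsupp.onFinset (Finset.range (mu.colLen 0)) mu.rowLen (by
    intro i hi
    rw [Finset.mem_range, ← YoungDiagram.mem_iff_lt_colLen, YoungDiagram.mem_iff_lt_rowLen]
    omega)

theorem card_filter_row (mu : YoungDiagram) (k : ℕ) :
    (mu.cells.filter fun c => c.1 = k).card = mu.rowLen k := by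
  rw [YoungDiagram.rowLen_eq_card]
  rfl

theorem kostka_self_ne_zero (mu : YoungDiagram) : kostka mu (rowContent mu) ≠ 0 := by
  refine (Set.ncard_pos (finite_hasContent mu _)).mpr
    ⟨SemistandardYoungTableau.highestWeight mu, ?_⟩ |>.ne'
  intro k
  change _ = mu.rowLen k
  rw [← card_filter_row]
  congr 1
  refine Finset.filter_congr ?_
  intro c hc
  have : (c.1, c.2) ∈ mu := by simpa using hc
  simp [SemistandardYoungTableau.highestWeight_apply, this]

theorem eq_of_rowLen_eq {lam mu : YoungDiagram} (h : ∀ k, lam.rowLen k = mu.rowLen k) :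
    lam = mu := by
  refine SetLike.ext ?_
  rintro ⟨i, j⟩
  rw [YoungDiagram.mem_iff_lt_rowLen, YoungDiagram.mem_iff_lt_rowLen, h]

theorem sum_entries_eq {lam mu : YoungDiagram} (T : SemistandardYoungTableau lam)
    (hT : HasContent T (rowContent mu)) :
    ∑ c ∈ lam.cells, T c.1 c.2 = ∑ c ∈ mu.cells, c.1 := by
  classical
  obtain ⟨N, hN⟩ : ∃ N, (∀ c ∈ lam.cells, T c.1 c.2 ∈ Finset.range N) ∧
      ∀ c ∈ mu.cells, c.1 ∈ Finset.range N := by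
    refine ⟨(∑ c ∈ lam.cells, T c.1 c.2) + (∑ c ∈ mu.cells, c.1) + 1, ?_, ?_⟩
    · intro c hc
      have := Finset.single_le_sum (f := fun c : ℕ × ℕ => T c.1 c.2)
        (fun _ _ => Nat.zero_le _) hc
      simp only [Finset.mem_range] at this ⊢
      omega
    · intro c hc
      have := Finset.single_le_sum (f := fun c : ℕ × ℕ => c.1)
        (fun _ _ => Nat.zero_le _) hc
      simp only [Finset.mem_range] at this ⊢
      omega
  rw [← Finset.sum_fiberwise_of_maps_to hN.1, ← Finset.sum_fiberwise_of_maps_to hN.2]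
  refine Finset.sum_congr rfl fun k _ => ?_
  have h1 : ∑ c ∈ lam.cells with T c.1 c.2 = k, T c.1 c.2 = ∑ c ∈ lam.cells with T c.1 c.2 = k, k :=
    Finset.sum_congr rfl fun c hc => (Finset.mem_filter.mp hc).2
  have h2 : ∑ c ∈ mu.cells with c.1 = k, c.1 = ∑ c ∈ mu.cells with c.1 = k, k :=
    Finset.sum_congr rfl fun c hc => (Finset.mem_filter.mp hc).2
  rw [h1, h2, Finset.sum_const, Finset.sum_const, hT k, card_filter_row]
  rfl

theorem eq_or_lt_of_kostka_ne_zero {lam mu : YoungDiagram}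
    (h : kostka lam (rowContent mu) ≠ 0) :
    lam = mu ∨ ∑ c ∈ lam.cells, c.1 < ∑ c ∈ mu.cells, c.1 := by
  obtain ⟨T, hT⟩ := Set.nonempty_of_ncard_ne_zero h
  have hT : HasContent T (rowContent mu) := hT
  have hle : ∀ c ∈ lam.cells, c.1 ≤ T c.1 c.2 := fun c hc =>
    row_le_entry T c.1 c.2 (by simpa using hc)
  rcases (Finset.sum_le_sum hle).lt_or_eq with hlt | heq
  · exact Or.inr (hlt.trans_eq (sum_entries_eq T hT))
  · left
    have h1 := (Finset.sum_eq_sum_iff_of_le hle).mp heq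
    refine eq_of_rowLen_eq fun k => ?_
    have h2 : (lam.cells.filter fun c => T c.1 c.2 = k).card = mu.rowLen k := hT k
    rw [← h2, ← card_filter_row]
    congr 1
    exact Finset.filter_congr fun c hc => by rw [← h1 c hc]

theorem schur_expansion_zero {c : YoungDiagram → ℝ} (h : HasSchurExpansion 0 c) : c = 0 := by
  by_contra hc
  have hex : ∃ n, ∃ mu : YoungDiagram, c mu ≠ 0 ∧ ∑ x ∈ mu.cells, x.1 = n := by
    obtain ⟨mu, hmu⟩ := Function.ne_iff.mp hc
    exact ⟨_, mu, hmu, rfl⟩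
  classical
  obtain ⟨mu, hmu, hn⟩ := Nat.find_spec hex
  have hmin := fun n hlt => Nat.find_min (H := hex) (m := n) hlt
  have h1 := MvPowerSeries.WithPiTopology.hasSum_iff_hasSum_coeff.mp h (rowContent mu)
  have h2 := hasSum_single (f := fun lam => MvPowerSeries.coeff (rowContent mu)
    (c lam • schur lam)) mu (by
      intro lam hne
      change c lam * (kostka lam (rowContent mu) : ℝ) = 0
      by_contra h0
      obtain ⟨ha, hb⟩ := mul_ne_zero_iff.mp h0
      rcases eq_or_lt_of_kostka_ne_zero (by exact_mod_cast hb) with h3 | h3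
      · exact hne h3
      · rw [hn] at h3
        exact hmin _ h3 ⟨lam, ha, rfl⟩)
  have h3 : c mu * (kostka mu (rowContent mu) : ℝ) = 0 := h2.unique h1
  rcases mul_eq_zero.mp h3 with h4 | h4
  · exact hmu h4
  · exact kostka_self_ne_zero mu (by exact_mod_cast h4)

theorem HasSchurExpansion.unique {f : Series} {c c' : YoungDiagram → ℝ}
    (h : HasSchurExpansion f c) (h' : HasSchurExpansion f c') : c = c' := by
  have h1 : HasSchurExpansion 0 (c - c') := by
    have := HasSum.sub h h'
    rw [sub_self] at this
    simpa only [HasSchurExpansion, Pi.sub_apply, sub_smul] using this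
  exact sub_eq_zero.mp (schur_expansion_zero h1)

theorem card_eq_of_kostka_ne_zero {lam : YoungDiagram} {d : ℕ →₀ ℕ} (h : kostka lam d ≠ 0) :
    lam.card = d.degree := by
  obtain ⟨T, hT⟩ := Set.nonempty_of_ncard_ne_zero h
  have hT : HasContent T d := hT
  have hm : ∀ c ∈ lam.cells, T c.1 c.2 ∈ d.support := by
    intro c hc
    rw [Finsupp.mem_support_iff, ← hT (T c.1 c.2)]
    exact (Finset.card_pos.mpr ⟨c, by simp [hc]⟩).ne'
  rw [YoungDiagram.card, Finset.card_eq_sum_card_fiberwise hm, Finsupp.degree]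
  exact Finset.sum_congr rfl fun k _ => hT k

theorem finite_card_eq (n : ℕ) : {lam : YoungDiagram | lam.card = n}.Finite := by
  classical
  refine Set.Finite.of_finite_image (f := YoungDiagram.cells) ?_ ?_
  · refine (Finset.finite_toSet (Finset.range n ×ˢ Finset.range n).powerset).subset ?_
    rintro _ ⟨lam, hlam, rfl⟩
    have hlam : lam.cells.card = n := hlam
    simp only [Finset.coe_powerset, Set.mem_preimage, Set.mem_powerset_iff, Finset.coe_subset]
    rintro ⟨i, j⟩ hij
    have hij : (i, j) ∈ lam := by simpa using hij
    have hr : lam.rowLen i ≤ n := by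
      rw [YoungDiagram.rowLen_eq_card, ← hlam]
      exact Finset.card_le_card (Finset.filter_subset _ _)
    have hc : lam.colLen j ≤ n := by
      rw [YoungDiagram.colLen_eq_card, ← hlam]
      exact Finset.card_le_card (Finset.filter_subset _ _)
    have h1 := YoungDiagram.mem_iff_lt_rowLen.mp hij
    have h2 := YoungDiagram.mem_iff_lt_colLen.mp hij
    simp only [Finset.mem_product, Finset.mem_range]
    omega
  · intro a _ b _ h
    exact YoungDiagram.ext h

/-- Any coefficients define an element of the completed ring of symmetric functions. -/
theorem summable_schur (c : YoungDiagram → ℝ) : Summable fun lam => c lam • schur lam := by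
  rw [MvPowerSeries.WithPiTopology.summable_iff_summable_coeff]
  intro d
  refine summable_of_hasFiniteSupport ((finite_card_eq d.degree).subset ?_)
  intro lam hlam
  have h0 : c lam * (kostka lam d : ℝ) ≠ 0 := hlam
  exact card_eq_of_kostka_ne_zero (by exact_mod_cast (mul_ne_zero_iff.mp h0).2)

theorem HasSchurExpansion.omega {f : Series} {c : YoungDiagram → ℝ} (h : HasSchurExpansion f c) :
    HasSchurExpansion (omega f) fun lam => c lam.transpose := by
  have hex : ∃ c : YoungDiagram → ℝ, HasSchurExpansion f c := ⟨c, h⟩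
  have hc : hex.choose = c := hex.choose_spec.unique h
  have h1 : KappaPositivity.omega f = ∑' lam : YoungDiagram, c lam • schur lam.transpose := by
    rw [KappaPositivity.omega, dif_pos hex, hc]
  let e : YoungDiagram ≃ YoungDiagram := YoungDiagram.transposeOrderIso.toEquiv
  have h2 : (fun lam : YoungDiagram => c lam • schur lam.transpose) =
      (fun lam => c lam.transpose • schur lam) ∘ e := by
    funext lam
    change _ = c lam.transpose.transpose • schur lam.transpose
    rw [YoungDiagram.transpose_transpose]
  have h3 : ∑' lam, ((fun lam : YoungDiagram => c lam.transpose • schur lam) ∘ e) lam =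
      ∑' lam : YoungDiagram, c lam.transpose • schur lam :=
    e.tsum_eq (fun lam : YoungDiagram => c lam.transpose • schur lam)
  rw [h1, h2, h3]
  exact (summable_schur _).hasSum

theorem omega_schur (lam : YoungDiagram) : omega (schur lam) = schur lam.transpose := by
  classical
  have key : ∀ mu : YoungDiagram, HasSchurExpansion (schur mu) (Pi.single mu 1) := by
    intro mu
    have := hasSum_single (f := fun nu => (Pi.single mu 1 : YoungDiagram → ℝ) nu • schur nu) mu
      (fun nu hne => by simp [Pi.single_eq_of_ne hne])
    simpa [HasSchurExpansion] using this
  have h1 := (key lam).omega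
  have h2 : (fun mu : YoungDiagram => (Pi.single lam 1 : YoungDiagram → ℝ) mu.transpose) =
      Pi.single lam.transpose 1 := by
    funext mu
    by_cases h : mu = lam.transpose
    · subst h; simp [YoungDiagram.transpose_transpose]
    · have h' : mu.transpose ≠ lam := fun h3 => h (by
        rw [← h3, YoungDiagram.transpose_transpose])
      rw [Pi.single_eq_of_ne h, Pi.single_eq_of_ne h']
  rw [h2] at h1
  exact HasSum.unique h1 (key _)

theorem multipliable_of_X_dvd (f : ℕ → Series)
    (h : ∀ j, (MvPowerSeries.X j : Series) ∣ f j - 1) : Multipliable f := by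
  have h1 : Multipliable (1 + (fun j => f j - 1) ·) := by
    refine MvPowerSeries.WithPiTopology.multipliable_one_add_of_tendsto_weightedOrder_atTop_nhds_top
      (w := id) ?_
    rw [ENat.tendsto_nhds_top_iff_natCast_lt]
    intro n
    filter_upwards [Filter.eventually_gt_atTop n] with j hj
    refine lt_of_lt_of_le (b := (j : ℕ∞)) (by exact_mod_cast hj)
      (MvPowerSeries.nat_le_weightedOrder _ ?_)
    intro d hd
    refine MvPowerSeries.X_dvd_iff.mp (h j) d ?_
    by_contra h0
    have h2 : id j ≤ Finsupp.weight id d := Finsupp.le_weight_of_ne_zero' id h0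
    exact absurd hd (not_lt.mpr h2)
  simpa using h1

theorem multipliable_subst_X (p : PowerSeries ℝ) (hp : p.constantCoeff = 1) :
    Multipliable fun i : ℕ => p.subst (MvPowerSeries.X i : Series) := by
  refine multipliable_of_X_dvd _ fun i => ?_
  have hX : PowerSeries.HasSubst (MvPowerSeries.X i : Series) := PowerSeries.HasSubst.X i
  obtain ⟨q, hq⟩ : PowerSeries.X ∣ p - 1 := by
    rw [PowerSeries.X_dvd_iff]; simp [hp]
  have hp' : p = 1 + PowerSeries.X * q := by rw [← hq]; ring
  refine ⟨q.subst (MvPowerSeries.X i : Series), ?_⟩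
  conv_lhs => rw [hp', ← PowerSeries.coe_substAlgHom hX]
  rw [← PowerSeries.coe_substAlgHom hX, map_add, map_mul, map_one, PowerSeries.substAlgHom_X hX]
  ring

theorem multipliable_one_sub_mul : Multipliable fun j : ℕ =>
    ∏ i ∈ Finset.range j, (1 - MvPowerSeries.X i * MvPowerSeries.X j : Series) := by
  refine multipliable_of_X_dvd _ fun j => ?_
  generalize Finset.range j = s
  induction s using Finset.induction_on with
  | empty => simp
  | insert a s ha ih =>
    rw [Finset.prod_insert ha]
    obtain ⟨g, hg⟩ := ih
    rw [sub_eq_iff_eq_add.mp hg]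
    exact ⟨g - MvPowerSeries.X a * (MvPowerSeries.X j * g + 1), by ring⟩

end

end KappaPositivity

/-! The identity `ω κ_p = κ_{p*}` comes from turning the variables, one at a time, from ordinary
into dual ones. Give each variable `x_i` a kind `τ i`. On the combinatorial side, Schur functions
are expanded in chains of diagrams in which an ordinary variable adds a horizontal strip and a dual
one a vertical strip (`chainCount`). If all variables are ordinary, this counts semistandard
tableaux; if all are dual, it counts those of the transposed shape. On the side of products,
`kernelProd` has the factor `1/(1 - x_i x_j)` for a pair of equal kinds, `1 + x_i x_j` for a pair of
different kinds, and `p(x_i)` or `p*(x_i)` for a single variable. All kinds ordinary gives `κ_p`,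
all dual gives `κ_{p*}`.

Both sides obey one cancellation law: a dual variable with value `-t` and an ordinary one with value
`t` drop out together (for chains, if their strips are added consecutively). For chains this is the
relation `∑ (-1)^j e_j h_{n-j} = 0`, proved by a sign-reversing involution
(`sum_addStrip_addStrip`). For products it is `p*(-t) (1 - t²) p(t) = 1`, which dictates the formula
for `p*` (`sum_coeff_kernelProd`). The law expresses a coefficient through coefficients with fewer
dual variables or with a smaller exponent of a dual variable. Hence the two sides agree for all
kinds once they agree when everything is ordinary (`sum_chainCount_eq_coeff_kernelProd`).

In the ordinary case the agreement is the Schur expansion of `κ_p`, which exists because `κ_p` is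
symmetric (`exists_hasSchurExpansion`). This uses the triangularity of the Kostka numbers and their
symmetry in the content; the symmetry holds because horizontal strips commute (`addStrip_comm`).
Positivity is preserved since `ω` only permutes Schur coefficients, and the dual is unique since
`κ_p` in one variable is `p` itself (`kappa_injective`). -/

namespace KappaPositivity

/-! ### Horizontal and vertical strips -/

/-- `ν / μ` is a horizontal strip: at most one cell in each column. -/
def HorizontalStrip (μ ν : YoungDiagram) : Prop :=
  μ ≤ ν ∧ ∀ i j, (i + 1, j) ∈ ν → (i, j) ∈ μ

/-- `ν / μ` is a vertical strip: at most one cell in each row. -/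
def VerticalStrip (μ ν : YoungDiagram) : Prop :=
  μ ≤ ν ∧ ∀ i j, (i, j + 1) ∈ ν → (i, j) ∈ μ

/-- A vertical strip if `v`, and a horizontal strip otherwise. -/
def IsStrip (v : Bool) (μ ν : YoungDiagram) : Prop :=
  if v then VerticalStrip μ ν else HorizontalStrip μ ν

theorem IsStrip.le {v : Bool} {μ ν : YoungDiagram} (h : IsStrip v μ ν) : μ ≤ ν := by
  cases v
  · exact h.1
  · exact h.1

theorem verticalStrip_transpose_iff {μ ν : YoungDiagram} :
    VerticalStrip μ.transpose ν.transpose ↔ HorizontalStrip μ ν := by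
  unfold VerticalStrip HorizontalStrip
  rw [YoungDiagram.transpose_le_iff]
  simp only [YoungDiagram.mem_transpose, Prod.swap_prod_mk]
  exact and_congr_right fun _ => ⟨fun h i j => h j i, fun h i j => h j i⟩

theorem card_le_card {μ ν : YoungDiagram} (h : μ ≤ ν) : μ.card ≤ ν.card :=
  Finset.card_le_card (YoungDiagram.cells_subset_iff.mpr h)

theorem card_transpose (μ : YoungDiagram) : μ.transpose.card = μ.card := by
  refine Finset.card_bij' (fun c _ => c.swap) (fun c _ => c.swap) ?_ ?_ ?_ ?_ <;>
    simp [YoungDiagram.mem_transpose]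

theorem eq_of_le_of_card_eq {μ ν : YoungDiagram} (h : μ ≤ ν) (hc : ν.card = μ.card) : μ = ν :=
  YoungDiagram.ext (Finset.eq_of_subset_of_card_le (YoungDiagram.cells_subset_iff.mpr h) hc.le)

theorem finite_strips (v : Bool) (n : ℕ) (ν : YoungDiagram) :
    {μ : YoungDiagram | IsStrip v μ ν ∧ ν.card = μ.card + n}.Finite := by
  refine (finite_card_eq (ν.card - n)).subset ?_
  rintro μ ⟨-, h⟩
  change μ.card = _
  omega

/-- The diagrams obtained from `ν` by removing a strip with `n` cells. -/
noncomputable def strips (v : Bool) (n : ℕ) (ν : YoungDiagram) : Finset YoungDiagram :=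
  (finite_strips v n ν).toFinset

theorem mem_strips {v : Bool} {n : ℕ} {μ ν : YoungDiagram} :
    μ ∈ strips v n ν ↔ IsStrip v μ ν ∧ ν.card = μ.card + n := by
  simp [strips]

/-- The operator that adds a strip with `n` cells in all possible ways. -/
noncomputable def addStrip (v : Bool) (n : ℕ) (g : YoungDiagram → ℝ) (ν : YoungDiagram) : ℝ :=
  ∑ μ ∈ strips v n ν, g μ

theorem strips_zero (v : Bool) (ν : YoungDiagram) : strips v 0 ν = {ν} := by
  ext μ
  rw [mem_strips, Finset.mem_singleton]
  refine ⟨fun h => eq_of_le_of_card_eq h.1.le h.2, ?_⟩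
  rintro rfl
  refine ⟨?_, rfl⟩
  cases v
  · exact ⟨le_rfl, fun i j h => μ.up_left_mem (Nat.le_succ i) le_rfl h⟩
  · exact ⟨le_rfl, fun i j h => μ.up_left_mem le_rfl (Nat.le_succ j) h⟩

theorem addStrip_zero (v : Bool) (g : YoungDiagram → ℝ) : addStrip v 0 g = g := by
  funext ν
  rw [addStrip, strips_zero, Finset.sum_singleton]

theorem addStrip_sum {ι : Type*} (v : Bool) (n : ℕ) (s : Finset ι) (a : ι → ℝ)
    (g : ι → YoungDiagram → ℝ) :
    addStrip v n (∑ j ∈ s, a j • g j) = ∑ j ∈ s, a j • addStrip v n (g j) := by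
  funext ν
  simp only [addStrip, Finset.sum_apply, Pi.smul_apply, smul_eq_mul, Finset.mul_sum]
  exact Finset.sum_comm

/-! ### Cancellation of vertical strips against horizontal strips -/

open Classical in
/-- Adds the cell `c` to `ν`, or removes it, if this gives a diagram. -/
noncomputable def toggle (c : ℕ × ℕ) (ν : YoungDiagram) : YoungDiagram :=
  if h : IsLowerSet ((symmDiff ν.cells {c} : Finset (ℕ × ℕ)) : Set (ℕ × ℕ)) then ⟨_, h⟩ else ν

/-- The cell `c` is the first cell of the last nonempty row of `lam / μ`. -/
structure IsPivot (μ lam : YoungDiagram) (c : ℕ × ℕ) : Prop where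
  mem : c ∈ lam
  notMem : c ∉ μ
  below : ∀ j, (c.1 + 1, j) ∈ lam → (c.1 + 1, j) ∈ μ
  left : ∀ b < c.2, (c.1, b) ∈ μ

theorem exists_isPivot {μ lam : YoungDiagram} (h : μ ≤ lam) (hne : μ ≠ lam) :
    ∃ c, IsPivot μ lam c := by
  have hex : (lam.cells \ μ.cells).Nonempty := by
    rw [Finset.sdiff_nonempty, YoungDiagram.cells_subset_iff]
    exact fun h' => hne (le_antisymm h h')
  obtain ⟨c, hc, hmax⟩ := Finset.exists_max_image _ (fun c : ℕ × ℕ => c.1) hex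
  obtain ⟨i, j⟩ := c
  simp only [Finset.mem_sdiff, YoungDiagram.mem_cells] at hc hmax
  refine ⟨(i, μ.rowLen i), ?_, ?_, ?_, ?_⟩
  · refine lam.up_left_mem le_rfl ?_ hc.1
    have := hc.2
    rw [YoungDiagram.mem_iff_lt_rowLen] at this
    omega
  · rw [YoungDiagram.mem_iff_lt_rowLen]
    exact lt_irrefl _
  · intro b hb
    by_contra hb'
    have := hmax (i + 1, b) ⟨hb, hb'⟩
    simp at this
  · intro b hb
    exact YoungDiagram.mem_iff_lt_rowLen.mpr hb

/-- The point is that `toggle` never falls back on its default here. The cells to the left of `c`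
lie in `μ` by the choice of the pivot, and those above it lie in `ν` because `lam / ν` is
horizontal, so `c` can be added. A cell of `ν` just to the right of `c` or just below it would force
`c ∈ μ`, so `c` can be removed. -/
theorem mem_toggle {μ lam ν : YoungDiagram} {c : ℕ × ℕ} (hc : IsPivot μ lam c)
    (hv : VerticalStrip μ ν) (hh : HorizontalStrip ν lam) (x : ℕ × ℕ) :
    x ∈ toggle c ν ↔ (x ∈ ν ↔ x ≠ c) := by
  have hlow : IsLowerSet ((symmDiff ν.cells {c} : Finset (ℕ × ℕ)) : Set (ℕ × ℕ)) := by
    obtain ⟨c1, c2⟩ := c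
    have h1 : (c1, c2 + 1) ∉ ν := fun h => hc.notMem (hv.2 _ _ h)
    have h2 : (c1 + 1, c2) ∉ ν := fun h =>
      hc.notMem (μ.up_left_mem (Nat.le_succ _) le_rfl (hc.below _ (hh.1 h)))
    rintro ⟨a1, a2⟩ ⟨b1, b2⟩ hab ha
    simp only [Finset.coe_symmDiff, Finset.coe_singleton, Set.mem_symmDiff, Finset.mem_coe,
      YoungDiagram.mem_cells, Set.mem_singleton_iff] at ha ⊢
    obtain ⟨hab1, hab2⟩ := Prod.mk_le_mk.mp hab
    rcases ha with ⟨ha, hne⟩ | ⟨ha, hn⟩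
    · left
      refine ⟨ν.up_left_mem hab1 hab2 ha, ?_⟩
      intro hbc
      obtain ⟨rfl, rfl⟩ := Prod.mk.inj hbc
      rcases hab1.eq_or_lt with rfl | hlt
      · rcases hab2.eq_or_lt with rfl | hlt
        · exact hne rfl
        · exact h1 (ν.up_left_mem le_rfl hlt ha)
      · exact h2 (ν.up_left_mem hlt hab2 ha)
    · obtain ⟨rfl, rfl⟩ := Prod.mk.inj ha
      by_cases hbc : (b1, b2) = (a1, a2)
      · right
        rw [hbc]
        exact ⟨rfl, hn⟩
      · left
        refine ⟨?_, hbc⟩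
        rcases hab1.eq_or_lt with rfl | hlt
        · rcases hab2.eq_or_lt with rfl | hlt
          · exact absurd rfl hbc
          · exact hv.1 (hc.left _ hlt)
        · exact hh.2 _ _ (lam.up_left_mem hlt hab2 hc.mem)
  rw [toggle, dif_pos hlow, YoungDiagram.mem_mk, Finset.mem_symmDiff, YoungDiagram.mem_cells,
    Finset.mem_singleton]
  tauto

theorem verticalStrip_toggle {μ lam ν : YoungDiagram} {c : ℕ × ℕ} (hc : IsPivot μ lam c)
    (hv : VerticalStrip μ ν) (hh : HorizontalStrip ν lam) : VerticalStrip μ (toggle c ν) := by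
  constructor
  · intro x hx
    rw [mem_toggle hc hv hh]
    exact ⟨fun _ h => hc.notMem (h ▸ hx), fun _ => hv.1 hx⟩
  · intro i j hij
    rw [mem_toggle hc hv hh] at hij
    by_cases h : (i, j + 1) = c
    · subst h
      exact hc.left j (Nat.lt_succ_self j)
    · exact hv.2 _ _ (hij.mpr h)

theorem horizontalStrip_toggle {μ lam ν : YoungDiagram} {c : ℕ × ℕ} (hc : IsPivot μ lam c)
    (hv : VerticalStrip μ ν) (hh : HorizontalStrip ν lam) : HorizontalStrip (toggle c ν) lam := by
  constructor
  · intro x hx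
    rw [mem_toggle hc hv hh] at hx
    by_cases h : x = c
    · exact h ▸ hc.mem
    · exact hh.1 (hx.mpr h)
  · intro i j hij
    rw [mem_toggle hc hv hh]
    refine ⟨fun _ h => ?_, fun _ => hh.2 _ _ hij⟩
    subst h
    exact hc.notMem (μ.up_left_mem (Nat.le_succ _) le_rfl (hc.below _ hij))

theorem toggle_toggle {μ lam ν : YoungDiagram} {c : ℕ × ℕ} (hc : IsPivot μ lam c)
    (hv : VerticalStrip μ ν) (hh : HorizontalStrip ν lam) : toggle c (toggle c ν) = ν := by
  refine SetLike.ext fun x => ?_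
  rw [mem_toggle hc (verticalStrip_toggle hc hv hh) (horizontalStrip_toggle hc hv hh),
    mem_toggle hc hv hh]
  tauto

theorem card_toggle {μ lam ν : YoungDiagram} {c : ℕ × ℕ} (hc : IsPivot μ lam c)
    (hv : VerticalStrip μ ν) (hh : HorizontalStrip ν lam) :
    (toggle c ν).card = ν.card + 1 ∨ ν.card = (toggle c ν).card + 1 := by
  by_cases h : c ∈ ν
  · right
    have : (toggle c ν).cells = ν.cells.erase c := by
      ext x
      rw [YoungDiagram.mem_cells, mem_toggle hc hv hh, Finset.mem_erase, YoungDiagram.mem_cells]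
      by_cases hx : x = c
      · subst hx; simp [h]
      · simp [hx]
    rw [YoungDiagram.card, YoungDiagram.card, this]
    exact (Finset.card_erase_add_one (YoungDiagram.mem_cells c |>.mpr h)).symm
  · left
    have : (toggle c ν).cells = insert c ν.cells := by
      ext x
      rw [YoungDiagram.mem_cells, mem_toggle hc hv hh, Finset.mem_insert, YoungDiagram.mem_cells]
      by_cases hx : x = c
      · subst hx; simp [h]
      · simp [hx]
    rw [YoungDiagram.card, YoungDiagram.card, this]
    exact Finset.card_insert_of_notMem (fun h' => h (YoungDiagram.mem_cells c |>.mp h'))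

open Classical in
/-- A pivot of `lam / μ`, when there is one. -/
noncomputable def pivot (μ lam : YoungDiagram) : ℕ × ℕ :=
  if h : ∃ c, IsPivot μ lam c then h.choose else 0

theorem isPivot_pivot {μ lam : YoungDiagram} (h : μ ≤ lam) (hc : μ.card ≠ lam.card) :
    IsPivot μ lam (pivot μ lam) := by
  have hex := exists_isPivot h fun he => hc (by rw [he])
  rw [pivot, dif_pos hex]
  exact hex.choose_spec

/-- Adding a vertical strip and then a horizontal strip, with `n` cells in total and with the sign
given by the size of the vertical strip, gives zero. -/
theorem sum_addStrip_addStrip (g : YoungDiagram → ℝ) {n : ℕ} (hn : 0 < n) :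
    ∑ j ∈ Finset.range (n + 1), (-1 : ℝ) ^ j • addStrip false (n - j) (addStrip true j g) = 0 := by
  funext lam
  simp only [addStrip, Finset.sum_apply, Pi.smul_apply, smul_eq_mul, Finset.mul_sum,
    Pi.zero_apply]
  simp_rw [Finset.sum_sigma']
  have key : ∀ x : (_ : ℕ) × (_ : YoungDiagram) × YoungDiagram,
      x ∈ (Finset.range (n + 1)).sigma
        (fun j => (strips false (n - j) lam).sigma fun ν => strips true j ν) ↔
      x.1 ≤ n ∧ HorizontalStrip x.2.1 lam ∧ lam.card = x.2.1.card + (n - x.1) ∧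
        VerticalStrip x.2.2 x.2.1 ∧ x.2.1.card = x.2.2.card + x.1 := by
    rintro ⟨j, ν, μ⟩
    simp [mem_strips, IsStrip, and_assoc]
  have hpiv : ∀ x : (_ : ℕ) × (_ : YoungDiagram) × YoungDiagram,
      x ∈ (Finset.range (n + 1)).sigma
        (fun j => (strips false (n - j) lam).sigma fun ν => strips true j ν) →
      IsPivot x.2.2 lam (pivot x.2.2 lam) := by
    rintro ⟨j, ν, μ⟩ hx
    obtain ⟨h1, h2, h3, h4, h5⟩ := (key _).mp hx
    dsimp only at h1 h2 h3 h4 h5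
    -- This is where `0 < n` enters: `lam / μ` has `n` cells, so it is nonempty and has a pivot.
    exact isPivot_pivot (h4.1.trans h2.1) (by dsimp only; omega)
  -- Move the pivot cell between the vertical and the horizontal strip. The pivot depends only on
  -- `μ` and `lam`, which stay fixed, so this is an involution; the size of the vertical strip
  -- changes by one, which reverses the sign.
  refine Finset.sum_involution (fun x _ =>
    ⟨(toggle (pivot x.2.2 lam) x.2.1).card - x.2.2.card,
      toggle (pivot x.2.2 lam) x.2.1, x.2.2⟩) ?_ ?_ ?_ ?_
  · rintro ⟨j, ν, μ⟩ hx
    have hc := hpiv _ hx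
    obtain ⟨h1, h2, h3, h4, h5⟩ := (key _).mp hx
    dsimp only at h1 h2 h3 h4 h5 hc ⊢
    have h6 := card_le_card (verticalStrip_toggle hc h4 h2).1
    rcases card_toggle hc h4 h2 with h | h
    · have : (toggle (pivot μ lam) ν).card - μ.card = j + 1 := by omega
      rw [this, pow_succ]; ring
    · obtain ⟨k, rfl⟩ : ∃ k, j = k + 1 := ⟨j - 1, by omega⟩
      have : (toggle (pivot μ lam) ν).card - μ.card = k := by omega
      rw [this, pow_succ]; ring
  · rintro ⟨j, ν, μ⟩ hx - heq
    have hc := hpiv _ hx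
    obtain ⟨h1, h2, h3, h4, h5⟩ := (key _).mp hx
    dsimp only at h1 h2 h3 h4 h5 hc
    simp only [Sigma.mk.injEq, heq_eq_eq, and_true] at heq
    have := card_toggle hc h4 h2
    rw [heq.2] at this
    omega
  · rintro ⟨j, ν, μ⟩ hx
    have hc := hpiv _ hx
    rw [key] at hx ⊢
    obtain ⟨h1, h2, h3, h4, h5⟩ := hx
    dsimp only at h1 h2 h3 h4 h5 hc ⊢
    have hv := verticalStrip_toggle hc h4 h2
    have hh := horizontalStrip_toggle hc h4 h2
    have hv' := card_le_card hv.1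
    have hh' := card_le_card hh.1
    exact ⟨by omega, hh, by omega, hv, by omega⟩
  · rintro ⟨j, ν, μ⟩ hx
    have hc := hpiv _ hx
    obtain ⟨h1, h2, h3, h4, h5⟩ := (key _).mp hx
    dsimp only at h1 h2 h3 h4 h5 hc ⊢
    rw [toggle_toggle hc h4 h2]
    have : ν.card - μ.card = j := by omega
    rw [this]

/-! ### Horizontal strips commute -/

/-- The interlacing form turns questions about horizontal strips into linear inequalities between
row lengths. -/
theorem horizontalStrip_iff {μ ν : YoungDiagram} :
    HorizontalStrip μ ν ↔ ∀ i, ν.rowLen (i + 1) ≤ μ.rowLen i ∧ μ.rowLen i ≤ ν.rowLen i := by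
  constructor
  · rintro ⟨h1, h2⟩ i
    constructor
    · by_contra! h
      exact lt_irrefl _ (YoungDiagram.mem_iff_lt_rowLen.mp
        (h2 _ _ (YoungDiagram.mem_iff_lt_rowLen.mpr h)))
    · by_contra! h
      exact lt_irrefl _ (YoungDiagram.mem_iff_lt_rowLen.mp
        (h1 (YoungDiagram.mem_iff_lt_rowLen.mpr h)))
  · intro h
    constructor
    · rintro ⟨i, j⟩ hij
      change (i, j) ∈ μ at hij
      rw [YoungDiagram.mem_iff_lt_rowLen] at hij ⊢
      exact hij.trans_le (h i).2
    · intro i j hij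
      rw [YoungDiagram.mem_iff_lt_rowLen] at hij ⊢
      exact hij.trans_le (h i).1

theorem exists_rowLen_eq {f : ℕ → ℕ} (hf : Antitone f) {N : ℕ} (hN : f N = 0) :
    ∃ ν : YoungDiagram, ∀ i, ν.rowLen i = f i := by
  refine ⟨⟨((Finset.range N) ×ˢ (Finset.range (f 0))).filter fun c => c.2 < f c.1, ?_⟩, ?_⟩
  · rintro ⟨a1, a2⟩ ⟨b1, b2⟩ hab ha
    obtain ⟨hab1, hab2⟩ := Prod.mk_le_mk.mp hab
    simp only [Finset.coe_filter, Finset.mem_product, Finset.mem_range, Set.mem_ofPred_eq] at ha ⊢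
    have := hf hab1
    omega
  · intro i
    refine eq_of_forall_lt_iff fun j => ?_
    rw [← YoungDiagram.mem_iff_lt_rowLen, ← YoungDiagram.mem_cells]
    simp only [Finset.mem_filter, Finset.mem_product, Finset.mem_range]
    refine ⟨fun h => h.2, fun h => ⟨⟨?_, h.trans_le (hf (Nat.zero_le i))⟩, h⟩⟩
    by_contra! hi
    have := hf hi
    omega

theorem card_eq_sum_rowLen (ν : YoungDiagram) {N : ℕ} (hN : ν.rowLen N = 0) :
    ν.card = ∑ i ∈ Finset.range N, ν.rowLen i := by
  rw [YoungDiagram.card, Finset.card_eq_sum_card_fiberwise (f := Prod.fst) (t := Finset.range N)]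
  · refine Finset.sum_congr rfl fun i _ => ?_
    exact card_filter_row ν i
  · rintro ⟨i, j⟩ hij
    have hij : (i, j) ∈ ν := by simpa using hij
    simp only [Finset.coe_range, Set.mem_Iio]
    by_contra! hi
    rw [YoungDiagram.mem_iff_lt_rowLen] at hij
    have := ν.rowLen_anti _ _ hi
    omega

theorem exists_rowLen_eq_zero (ν : YoungDiagram) : ∃ N, ν.rowLen N = 0 := by
  refine ⟨ν.colLen 0, ?_⟩
  by_contra h
  have h1 : (ν.colLen 0, 0) ∈ ν := YoungDiagram.mem_iff_lt_rowLen.mpr (Nat.pos_of_ne_zero h)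
  exact lt_irrefl _ (YoungDiagram.mem_iff_lt_colLen.mp h1)

open Classical in
/-- The diagram with row lengths `f`, when there is one. -/
noncomputable def ofRows (f : ℕ → ℕ) : YoungDiagram :=
  if h : ∃ ν : YoungDiagram, ∀ i, ν.rowLen i = f i then h.choose else ⊥

theorem rowLen_ofRows {f : ℕ → ℕ} (hf : Antitone f) {N : ℕ} (hN : f N = 0) (i : ℕ) :
    (ofRows f).rowLen i = f i := by
  have h := exists_rowLen_eq hf hN
  rw [ofRows, dif_pos h]
  exact h.choose_spec i

/-- The sum of the bounds on the length of row `i` of a diagram between `μ` and `lam`. -/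
def boundSum (μ lam : YoungDiagram) : ℕ → ℕ
  | 0 => max (μ.rowLen 0) (lam.rowLen 1) + lam.rowLen 0
  | i + 1 => max (μ.rowLen (i + 1)) (lam.rowLen (i + 2)) + min (lam.rowLen (i + 1)) (μ.rowLen i)

/-- Reflects the row lengths of `ν` between the bounds that `μ` and `lam` impose on them. -/
noncomputable def reflectRows (μ lam ν : YoungDiagram) : YoungDiagram :=
  ofRows fun i => boundSum μ lam i - ν.rowLen i

/-- Interlacing with `μ` and `lam` confines each row of `ν` to an interval that does not depend on
the other rows: from `max μ_i lam_{i+1}` to `min lam_i μ_{i-1}`, with upper end `lam_0` for `i = 0`.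
So the reflections can be made row by row. The subtraction is not truncated, and since `μ_i`
separates the intervals of rows `i` and `i + 1`, the reflected lengths still decrease. -/
theorem rowLen_reflectRows {μ lam ν : YoungDiagram} (h1 : HorizontalStrip μ ν)
    (h2 : HorizontalStrip ν lam) (i : ℕ) :
    (reflectRows μ lam ν).rowLen i = boundSum μ lam i - ν.rowLen i := by
  rw [horizontalStrip_iff] at h1 h2
  obtain ⟨N, hN⟩ := exists_rowLen_eq_zero lam
  refine rowLen_ofRows (N := N + 1) (antitone_nat_of_succ_le fun k => ?_) ?_ i
  · have a1 := h1 k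
    have a2 := h2 k
    have a3 := h1 (k + 1)
    have a4 := h2 (k + 1)
    cases k with
    | zero => simp only [boundSum, Nat.zero_add, Nat.reduceAdd] at *; omega
    | succ k =>
      have a5 := h1 k
      have a6 := h2 k
      simp only [boundSum, Nat.add_assoc, Nat.reduceAdd] at *; omega
  · have b1 := lam.rowLen_anti N (N + 1) (Nat.le_succ N)
    have b2 := lam.rowLen_anti N (N + 2) (by omega)
    have a3 := h1 (N + 1)
    have a4 := h2 (N + 1)
    simp only [boundSum]; omega

theorem horizontalStrip_reflectRows {μ lam ν : YoungDiagram} (h1 : HorizontalStrip μ ν)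
    (h2 : HorizontalStrip ν lam) :
    HorizontalStrip μ (reflectRows μ lam ν) ∧ HorizontalStrip (reflectRows μ lam ν) lam := by
  have h := rowLen_reflectRows h1 h2
  rw [horizontalStrip_iff] at h1 h2
  rw [horizontalStrip_iff, horizontalStrip_iff]
  constructor <;> intro k <;>
  · have a1 := h1 k
    have a2 := h2 k
    have a3 := h1 (k + 1)
    have a4 := h2 (k + 1)
    rw [h]
    try rw [h]
    cases k with
    | zero => simp only [boundSum, Nat.zero_add, Nat.reduceAdd] at *; omega
    | succ k =>
      have a5 := h1 k
      have a6 := h2 k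
      simp only [boundSum, Nat.add_assoc, Nat.reduceAdd] at *; omega

theorem reflectRows_reflectRows {μ lam ν : YoungDiagram} (h1 : HorizontalStrip μ ν)
    (h2 : HorizontalStrip ν lam) : reflectRows μ lam (reflectRows μ lam ν) = ν := by
  obtain ⟨h3, h4⟩ := horizontalStrip_reflectRows h1 h2
  refine eq_of_rowLen_eq fun k => ?_
  rw [rowLen_reflectRows h3 h4, rowLen_reflectRows h1 h2]
  rw [horizontalStrip_iff] at h1 h2
  have a1 := h1 k
  have a2 := h2 k
  cases k with
  | zero => simp only [boundSum, Nat.zero_add] at *; omega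
  | succ k =>
    have a5 := h1 k
    have a6 := h2 k
    simp only [boundSum, Nat.add_assoc, Nat.reduceAdd] at *; omega

/-- The maximum in the lower bound for row `i` and the minimum in the upper bound for row `i + 1`
are taken over the same two numbers, so together they contribute `μ_i + lam_{i+1}`. -/
theorem card_reflectRows {μ lam ν : YoungDiagram} (h1 : HorizontalStrip μ ν)
    (h2 : HorizontalStrip ν lam) :
    (reflectRows μ lam ν).card + ν.card = lam.card + μ.card := by
  obtain ⟨h3, h4⟩ := horizontalStrip_reflectRows h1 h2
  obtain ⟨N, hN⟩ := exists_rowLen_eq_zero lam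
  have hN' : lam.rowLen (N + 1) = 0 := by
    have := lam.rowLen_anti N (N + 1) (Nat.le_succ N); omega
  have hs := rowLen_reflectRows h1 h2
  rw [horizontalStrip_iff] at h1 h2 h3 h4
  have b1 := h1 N
  have b2 := h2 N
  have b3 := h1 (N + 1)
  have b4 := h2 (N + 1)
  have b5 := h3 N
  have b6 := h4 N
  have b7 := h4 (N + 1)
  rw [card_eq_sum_rowLen (reflectRows μ lam ν) (N := N + 1) (by omega),
    card_eq_sum_rowLen ν (N := N + 1) (by omega), card_eq_sum_rowLen lam hN',
    card_eq_sum_rowLen μ (N := N) (by omega), ← Finset.sum_add_distrib]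
  have e1 : ∑ i ∈ Finset.range (N + 1), ((reflectRows μ lam ν).rowLen i + ν.rowLen i) =
      ∑ i ∈ Finset.range (N + 1), boundSum μ lam i := by
    refine Finset.sum_congr rfl fun k _ => ?_
    have a1 := h1 k
    have a2 := h2 k
    rw [hs]
    cases k with
    | zero => simp only [boundSum, Nat.zero_add] at *; omega
    | succ k =>
      have a5 := h1 k
      have a6 := h2 k
      simp only [boundSum, Nat.add_assoc, Nat.reduceAdd] at *; omega
  have e2 : ∀ M, ∑ i ∈ Finset.range (M + 1), boundSum μ lam i =
      max (μ.rowLen M) (lam.rowLen (M + 1)) +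
        (∑ i ∈ Finset.range (M + 1), lam.rowLen i + ∑ i ∈ Finset.range M, μ.rowLen i) := by
    intro M
    induction M with
    | zero => simp [boundSum]
    | succ M ih =>
      rw [Finset.sum_range_succ, ih, Finset.sum_range_succ _ (M + 1),
        Finset.sum_range_succ (fun i => μ.rowLen i) M]
      simp only [boundSum, Nat.add_assoc, Nat.reduceAdd]
      omega
  rw [e1, e2, hN']
  omega

/-- For fixed `μ` and `lam`, reflecting the intermediate diagram row by row exchanges the sizes of
the two strips; this is the Bender–Knuth involution. -/
theorem addStrip_comm (a b : ℕ) (g : YoungDiagram → ℝ) :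
    addStrip false a (addStrip false b g) = addStrip false b (addStrip false a g) := by
  funext lam
  simp only [addStrip, Finset.sum_sigma']
  have key : ∀ (a b : ℕ) (x : (_ : YoungDiagram) × YoungDiagram),
      x ∈ (strips false a lam).sigma (fun ν => strips false b ν) ↔
      HorizontalStrip x.1 lam ∧ lam.card = x.1.card + a ∧
        HorizontalStrip x.2 x.1 ∧ x.1.card = x.2.card + b := by
    rintro a b ⟨ν, μ⟩
    simp [mem_strips, IsStrip, and_assoc]
  have hmem : ∀ (a b : ℕ) (x : (_ : YoungDiagram) × YoungDiagram),
      x ∈ (strips false a lam).sigma (fun ν => strips false b ν) →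
      (⟨reflectRows x.2 lam x.1, x.2⟩ : (_ : YoungDiagram) × YoungDiagram) ∈
        (strips false b lam).sigma (fun ν => strips false a ν) := by
    rintro a b ⟨ν, μ⟩ hx
    rw [key] at hx ⊢
    obtain ⟨h1, h2, h3, h4⟩ := hx
    dsimp only at h1 h2 h3 h4 ⊢
    have h5 := horizontalStrip_reflectRows h3 h1
    have h6 := card_reflectRows h3 h1
    exact ⟨h5.2, by omega, h5.1, by omega⟩
  refine Finset.sum_bij' (fun x _ => ⟨reflectRows x.2 lam x.1, x.2⟩)
    (fun x _ => ⟨reflectRows x.2 lam x.1, x.2⟩) (hmem a b) (hmem b a) ?_ ?_ ?_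
  · rintro ⟨ν, μ⟩ hx
    obtain ⟨h1, h2, h3, h4⟩ := (key _ _ _).mp hx
    dsimp only at h1 h2 h3 h4 ⊢
    rw [reflectRows_reflectRows h3 h1]
  · rintro ⟨ν, μ⟩ hx
    obtain ⟨h1, h2, h3, h4⟩ := (key _ _ _).mp hx
    dsimp only at h1 h2 h3 h4 ⊢
    rw [reflectRows_reflectRows h3 h1]
  · rintro ⟨ν, μ⟩ hx
    rfl

/-! ### Kostka numbers count chains of strips -/

/-- Counts the chains of diagrams from the empty one in which a strip of type `τ i` with `e i` cells
is added for each `i` in `L`, the last one first. -/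
noncomputable def chainCount (L : List ℕ) (τ : ℕ → Bool) (e : ℕ → ℕ) : YoungDiagram → ℝ :=
  L.foldr (fun i g => addStrip (τ i) (e i) g) (({⊥} : Set YoungDiagram).indicator 1)

theorem chainCount_nil (τ : ℕ → Bool) (e : ℕ → ℕ) : chainCount [] τ e = ({⊥} : Set YoungDiagram).indicator 1 := rfl

theorem chainCount_cons (i : ℕ) (L : List ℕ) (τ : ℕ → Bool) (e : ℕ → ℕ) :
    chainCount (i :: L) τ e = addStrip (τ i) (e i) (chainCount L τ e) := rfl

theorem chainCount_congr {L : List ℕ} {τ τ' : ℕ → Bool} {e e' : ℕ → ℕ}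
    (h : ∀ i ∈ L, addStrip (τ i) (e i) = addStrip (τ' i) (e' i)) :
    chainCount L τ e = chainCount L τ' e' := by
  induction L with
  | nil => rfl
  | cons i L ih =>
    rw [chainCount_cons, chainCount_cons, ih fun j hj => h j (List.mem_cons_of_mem _ hj),
      h i List.mem_cons_self]

theorem chainCount_append_of_eq_zero {L M : List ℕ} {τ : ℕ → Bool} {e : ℕ → ℕ}
    (h : ∀ i ∈ M, e i = 0) : chainCount (L ++ M) τ e = chainCount L τ e := by
  induction L with
  | nil =>
    induction M with
    | nil => rfl
    | cons i M ih =>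
      rw [List.nil_append] at ih ⊢
      rw [chainCount_cons, ih fun j hj => h j (List.mem_cons_of_mem _ hj),
        h i List.mem_cons_self, addStrip_zero]
  | cons i L ih => rw [List.cons_append, chainCount_cons, chainCount_cons, ih]

theorem chainCount_perm {L M : List ℕ} (h : L.Perm M) (e : ℕ → ℕ) :
    chainCount L (fun _ => false) e = chainCount M (fun _ => false) e := by
  have : LeftCommutative fun (i : ℕ) (g : YoungDiagram → ℝ) => addStrip false (e i) g :=
    ⟨fun a b g => addStrip_comm _ _ g⟩
  exact h.foldr_eq _

theorem addStrip_transpose (n : ℕ) (g : YoungDiagram → ℝ) (lam : YoungDiagram) :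
    addStrip true n (fun μ => g μ.transpose) lam = addStrip false n g lam.transpose := by
  refine Finset.sum_bij' (fun μ _ => μ.transpose) (fun μ _ => μ.transpose) ?_ ?_ ?_ ?_ ?_
  · intro μ hμ
    rw [mem_strips] at hμ ⊢
    refine ⟨?_, by rw [card_transpose, card_transpose]; exact hμ.2⟩
    rw [IsStrip, if_neg (by simp), ← verticalStrip_transpose_iff]
    simpa [IsStrip] using hμ.1
  · intro μ hμ
    rw [mem_strips] at hμ ⊢
    refine ⟨?_, by rw [card_transpose, ← hμ.2, card_transpose]⟩
    have h := hμ.1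
    rw [IsStrip, if_neg (by simp), ← verticalStrip_transpose_iff] at h
    simpa [IsStrip] using h
  · simp
  · simp
  · simp

theorem chainCount_transpose (L : List ℕ) (e : ℕ → ℕ) (lam : YoungDiagram) :
    chainCount L (fun _ => true) e lam = chainCount L (fun _ => false) e lam.transpose := by
  induction L generalizing lam with
  | nil =>
    have h : lam.transpose = ⊥ ↔ lam = ⊥ := by
      rw [YoungDiagram.transpose_eq_iff_eq_transpose]
      exact Iff.of_eq (congrArg _ (YoungDiagram.ext (by ext; simp [YoungDiagram.mem_transpose])))
    rw [chainCount_nil, chainCount_nil]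
    by_cases h' : lam = ⊥
    · rw [Set.indicator_of_mem (s := {⊥}) h', Set.indicator_of_mem (s := {⊥}) (h.mpr h')]
      rfl
    · rw [Set.indicator_of_notMem (s := {⊥}) h', Set.indicator_of_notMem (s := {⊥}) (mt h.mp h')]
  | cons i L ih =>
    rw [chainCount_cons, chainCount_cons, ← addStrip_transpose]
    congr 1
    funext μ
    exact ih μ

/-! ### Tableaux as chains: removing the largest entries -/

theorem entry_mem_support {lam : YoungDiagram} {T : SemistandardYoungTableau lam} {d : ℕ →₀ ℕ}
    (hT : HasContent T d) {c : ℕ × ℕ} (hc : c ∈ lam) : T c.1 c.2 ∈ d.support := by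
  rw [Finsupp.mem_support_iff, ← hT (T c.1 c.2)]
  exact (Finset.card_pos.mpr ⟨c, by simp [hc]⟩).ne'

/-- The cells in which a tableau has an entry less than `k`. -/
def subshape {lam : YoungDiagram} (T : SemistandardYoungTableau lam) (k : ℕ) : YoungDiagram where
  cells := lam.cells.filter fun c => T c.1 c.2 < k
  isLowerSet := by
    rintro ⟨a1, a2⟩ ⟨b1, b2⟩ hab ha
    obtain ⟨hab1, hab2⟩ := Prod.mk_le_mk.mp hab
    simp only [Finset.coe_filter, YoungDiagram.mem_cells, Set.mem_ofPred_eq] at ha ⊢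
    refine ⟨lam.up_left_mem hab1 hab2 ha.1, ?_⟩
    exact ((T.row_weak_of_le hab2 (lam.up_left_mem hab1 le_rfl ha.1)).trans
      (T.col_weak hab1 ha.1)).trans_lt ha.2

theorem mem_subshape {lam : YoungDiagram} {T : SemistandardYoungTableau lam} {k : ℕ} {c : ℕ × ℕ} :
    c ∈ subshape T k ↔ c ∈ lam ∧ T c.1 c.2 < k := by
  rw [← YoungDiagram.mem_cells, subshape, Finset.mem_filter, YoungDiagram.mem_cells]

/-- The restriction of a tableau to a smaller shape. -/
def restrictTableau {lam μ : YoungDiagram} (h : μ ≤ lam) (T : SemistandardYoungTableau lam) :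
    SemistandardYoungTableau μ where
  entry i j := if (i, j) ∈ μ then T i j else 0
  row_weak' hj hc := by
    rw [if_pos hc, if_pos (μ.up_left_mem le_rfl hj.le hc)]
    exact T.row_weak hj (h hc)
  col_strict' hi hc := by
    rw [if_pos hc, if_pos (μ.up_left_mem hi.le le_rfl hc)]
    exact T.col_strict hi (h hc)
  zeros' hc := if_neg hc

theorem restrictTableau_apply {lam μ : YoungDiagram} (h : μ ≤ lam)
    (T : SemistandardYoungTableau lam) (i j : ℕ) :
    restrictTableau h T i j = if (i, j) ∈ μ then T i j else 0 := rfl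

/-- The extension of a tableau by a horizontal strip filled with `k`. -/
def extendTableau {lam μ : YoungDiagram} (h : HorizontalStrip μ lam) (k : ℕ)
    (T : SemistandardYoungTableau μ) (hT : ∀ c ∈ μ, T c.1 c.2 < k) :
    SemistandardYoungTableau lam where
  entry i j := if (i, j) ∈ μ then T i j else if (i, j) ∈ lam then k else 0
  row_weak' {i j1 j2} hj hc := by
    by_cases h2 : (i, j2) ∈ μ
    · rw [if_pos h2, if_pos (μ.up_left_mem le_rfl hj.le h2)]
      exact T.row_weak hj h2
    · rw [if_neg h2, if_pos hc]
      split_ifs with h1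
      · exact (hT _ h1).le
      · exact le_rfl
      · exact Nat.zero_le k
  col_strict' {i1 i2 j} hi hc := by
    have h1 : (i1, j) ∈ μ := h.2 _ _ (lam.up_left_mem hi le_rfl hc)
    rw [if_pos h1]
    by_cases h2 : (i2, j) ∈ μ
    · rw [if_pos h2]
      exact T.col_strict hi h2
    · rw [if_neg h2, if_pos hc]
      exact hT _ h1
  zeros' {i j} hc := by rw [if_neg fun h' => hc (h.1 h'), if_neg hc]

theorem extendTableau_apply {lam μ : YoungDiagram} (h : HorizontalStrip μ lam) (k : ℕ)
    (T : SemistandardYoungTableau μ) (hT : ∀ c ∈ μ, T c.1 c.2 < k) (i j : ℕ) :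
    extendTableau h k T hT i j = if (i, j) ∈ μ then T i j else if (i, j) ∈ lam then k else 0 := rfl

theorem subshape_mem_strips {lam : YoungDiagram} {d : ℕ →₀ ℕ} {k : ℕ}
    (hd : d.support ⊆ Finset.range (k + 1)) {T : SemistandardYoungTableau lam}
    (hT : HasContent T d) : subshape T k ∈ strips false (d k) lam := by
  have hle : ∀ c ∈ lam, T c.1 c.2 ≤ k := fun c hc =>
    Nat.lt_succ_iff.mp (Finset.mem_range.mp (hd (entry_mem_support hT hc)))
  rw [mem_strips, IsStrip, if_neg (by simp)]
  refine ⟨⟨fun c hc => (mem_subshape.mp hc).1, fun i j hij => mem_subshape.mpr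
    ⟨lam.up_left_mem (Nat.le_succ i) le_rfl hij,
      (T.col_strict (Nat.lt_succ_self i) hij).trans_le (hle _ hij)⟩⟩, ?_⟩
  rw [← hT k, YoungDiagram.card, YoungDiagram.card, subshape,
    ← Finset.card_filter_add_card_filter_not (s := lam.cells) fun c => T c.1 c.2 < k]
  congr 2
  refine Finset.filter_congr fun c hc => ?_
  have := hle c (by simpa using hc)
  omega

/-- No entry exceeds `k`, so outside `subshape T k` every cell of `lam` carries `k`. Thus `T` is
determined by its restriction to `μ`, and filling the strip with `k` inverts the restriction. -/
theorem card_filter_subshape_eq {lam μ : YoungDiagram} {d : ℕ →₀ ℕ} {k : ℕ}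
    (hd : d.support ⊆ Finset.range (k + 1)) (hμ : μ ∈ strips false (d k) lam) :
    {T : SemistandardYoungTableau lam | HasContent T d ∧ subshape T k = μ}.ncard =
      kostka μ (d.erase k) := by
  rw [mem_strips, IsStrip, if_neg (by simp)] at hμ
  obtain ⟨hs, hcard⟩ := hμ
  refine Set.ncard_congr (fun T _ => restrictTableau hs.1 T) ?_ ?_ ?_
  · rintro T ⟨hT, rfl⟩ i
    have hle : ∀ c ∈ lam, T c.1 c.2 ≤ k := fun c hc =>
      Nat.lt_succ_iff.mp (Finset.mem_range.mp (hd (entry_mem_support hT hc)))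
    by_cases hi : i = k
    · subst hi
      rw [Finsupp.erase_same, Finset.card_eq_zero, Finset.filter_eq_empty_iff]
      intro c hc
      rw [YoungDiagram.mem_cells] at hc
      rw [restrictTableau_apply, if_pos hc]
      exact (mem_subshape.mp hc).2.ne
    · rw [Finsupp.erase_ne hi, ← hT i]
      congr 1
      ext c
      simp only [Finset.mem_filter, YoungDiagram.mem_cells]
      constructor
      · rintro ⟨hc, h⟩
        rw [restrictTableau_apply, if_pos hc] at h
        exact ⟨hs.1 hc, h⟩
      · rintro ⟨hc, h⟩
        have hc' : c ∈ subshape T k := mem_subshape.mpr ⟨hc, by have := hle c hc; omega⟩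
        exact ⟨hc', by rwa [restrictTableau_apply, if_pos hc']⟩
  · rintro T T' ⟨hT, hTμ⟩ ⟨hT', hTμ'⟩ h
    ext i j
    have hle : ∀ {T : SemistandardYoungTableau lam}, HasContent T d → ∀ c ∈ lam,
        T c.1 c.2 ≤ k := fun hT c hc =>
      Nat.lt_succ_iff.mp (Finset.mem_range.mp (hd (entry_mem_support hT hc)))
    by_cases hμ : (i, j) ∈ μ
    · have := DFunLike.congr_fun h i
      have := congrFun this j
      rwa [restrictTableau_apply, restrictTableau_apply, if_pos hμ, if_pos hμ] at this
    · by_cases hlam : (i, j) ∈ lam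
      · have h1 : ¬ T i j < k := fun h => hμ (hTμ ▸ mem_subshape.mpr ⟨hlam, h⟩)
        have h2 : ¬ T' i j < k := fun h => hμ (hTμ' ▸ mem_subshape.mpr ⟨hlam, h⟩)
        have h3 := hle hT _ hlam
        have h4 := hle hT' _ hlam
        dsimp only at h3 h4
        omega
      · rw [T.zeros hlam, T'.zeros hlam]
  · intro T hT
    change HasContent T _ at hT
    have hlt : ∀ c ∈ μ, T c.1 c.2 < k := by
      intro c hc
      have h1 := entry_mem_support hT hc
      rw [Finsupp.support_erase, Finset.mem_erase] at h1
      have h2 := Finset.mem_range.mp (hd h1.2)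
      have h3 := h1.1
      omega
    have hmem : ∀ c : ℕ × ℕ, c ∈ μ ↔ c ∈ lam ∧ extendTableau hs k T hlt c.1 c.2 < k := by
      intro c
      rw [extendTableau_apply]
      by_cases hc : c ∈ μ
      · rw [if_pos hc]
        exact ⟨fun _ => ⟨hs.1 hc, hlt c hc⟩, fun _ => hc⟩
      · rw [if_neg hc]
        refine ⟨fun h => absurd h hc, ?_⟩
        rintro ⟨h1, h2⟩
        rw [if_pos h1] at h2
        exact absurd h2 (lt_irrefl _)
    refine ⟨extendTableau hs k T hlt, ⟨?_, ?_⟩, ?_⟩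
    · intro i
      by_cases hi : i = k
      · subst hi
        have h1 : (lam.cells.filter fun c => extendTableau hs i T hlt c.1 c.2 = i) =
            lam.cells \ μ.cells := by
          ext c
          simp only [Finset.mem_filter, Finset.mem_sdiff, YoungDiagram.mem_cells]
          refine and_congr_right fun hc => ?_
          rw [extendTableau_apply]
          by_cases h : c ∈ μ
          · rw [if_pos h]
            exact iff_of_false (hlt c h).ne (not_not.mpr h)
          · rw [if_neg h, if_pos hc]
            exact iff_of_true rfl h
        have h2 : (lam.cells \ μ.cells).card = lam.cells.card - μ.cells.card :=
          Finset.card_sdiff_of_subset (YoungDiagram.cells_subset_iff.mpr hs.1)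
        have h3 : lam.cells.card = μ.cells.card + d i := hcard
        rw [h1, h2, h3, Nat.add_sub_cancel_left]
      · rw [← Finsupp.erase_ne hi, ← hT i]
        congr 1
        ext c
        simp only [Finset.mem_filter, YoungDiagram.mem_cells]
        rw [extendTableau_apply]
        by_cases h : c ∈ μ
        · rw [if_pos h]
          exact and_congr_left fun _ => iff_of_true (hs.1 h) h
        · rw [if_neg h]
          refine iff_of_false ?_ fun h' => h h'.1
          rintro ⟨h1, h2⟩
          rw [if_pos h1] at h2
          exact hi h2.symm
    · refine SetLike.ext fun c => ?_
      rw [mem_subshape, hmem]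
    · ext i j
      rw [restrictTableau_apply]
      by_cases h : (i, j) ∈ μ
      · rw [if_pos h, extendTableau_apply, if_pos h]
      · rw [if_neg h, T.zeros h]

theorem kostka_eq_sum {lam : YoungDiagram} {d : ℕ →₀ ℕ} {k : ℕ}
    (hd : d.support ⊆ Finset.range (k + 1)) :
    kostka lam d = ∑ μ ∈ strips false (d k) lam, kostka μ (d.erase k) := by
  classical
  have hfin := finite_hasContent lam d
  rw [kostka, Set.ncard_eq_toFinset_card _ hfin,
    Finset.card_eq_sum_card_fiberwise (f := fun T => subshape T k)
      (t := strips false (d k) lam)]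
  · refine Finset.sum_congr rfl fun μ hμ => ?_
    rw [← card_filter_subshape_eq hd hμ, ← Set.ncard_coe_finset]
    congr 1
    ext T
    simp
  · intro T hT
    exact subshape_mem_strips hd (by simpa using hT)

theorem kostka_zero (lam : YoungDiagram) :
    (kostka lam 0 : ℝ) = ({⊥} : Set YoungDiagram).indicator (1 : YoungDiagram → ℝ) lam := by
  by_cases h : lam = ⊥
  · subst h
    rw [Set.indicator_of_mem (Set.mem_singleton _), Pi.one_apply, Nat.cast_eq_one, kostka, Set.ncard_eq_one]
    refine ⟨SemistandardYoungTableau.highestWeight ⊥, ?_⟩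
    rw [Set.eq_singleton_iff_unique_mem]
    refine ⟨fun k => by simp, fun T _ => ?_⟩
    ext i j
    rw [T.zeros (YoungDiagram.notMem_bot _),
      (SemistandardYoungTableau.highestWeight ⊥).zeros (YoungDiagram.notMem_bot _)]
  · rw [Set.indicator_of_notMem (s := {⊥}) h, Nat.cast_eq_zero]
    by_contra h0
    have h1 := card_eq_of_kostka_ne_zero h0
    rw [map_zero, YoungDiagram.card, Finset.card_eq_zero] at h1
    exact h (YoungDiagram.ext h1)

theorem kostka_eq_chainCount_range (k : ℕ) {d : ℕ →₀ ℕ} (hd : d.support ⊆ Finset.range k)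
    (lam : YoungDiagram) :
    (kostka lam d : ℝ) = chainCount (List.range k).reverse (fun _ => false) d lam := by
  induction k generalizing d lam with
  | zero =>
    have : d = 0 := by simpa using hd
    subst this
    exact kostka_zero lam
  | succ k ih =>
    have hd' : (d.erase k).support ⊆ Finset.range k := by
      intro i hi
      rw [Finsupp.support_erase, Finset.mem_erase] at hi
      have := Finset.mem_range.mp (hd hi.2)
      have := hi.1
      rw [Finset.mem_range]
      omega
    rw [kostka_eq_sum hd, List.range_succ, List.reverse_append, List.reverse_singleton,
      List.singleton_append, chainCount_cons, Nat.cast_sum]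
    refine Finset.sum_congr rfl fun μ _ => ?_
    rw [ih hd']
    refine congrFun (chainCount_congr fun i hi => ?_) μ
    rw [List.mem_reverse, List.mem_range] at hi
    rw [Finsupp.erase_ne hi.ne]

/-- The entries may be used in any order, because horizontal strips commute, and unused entries add
empty strips. This freedom is needed later to place an auxiliary variable next to a given one. -/
theorem kostka_eq_chainCount {L : List ℕ} (hL : L.Nodup) {d : ℕ →₀ ℕ}
    (hd : ∀ i ∈ d.support, i ∈ L) (lam : YoungDiagram) :
    (kostka lam d : ℝ) = chainCount L (fun _ => false) d lam := by
  obtain ⟨k, hk⟩ : ∃ k, ∀ i ∈ L, i < k :=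
    ⟨L.toFinset.sup id + 1, fun i hi => Nat.lt_succ_iff.mpr
      (Finset.le_sup (f := id) (List.mem_toFinset.mpr hi))⟩
  rw [kostka_eq_chainCount_range k fun i hi => Finset.mem_range.mpr (hk i (hd i hi)),
    ← chainCount_append_of_eq_zero (L := L) (M := (List.range k).filter (· ∉ L))]
  · refine congrFun (chainCount_perm ?_ d) lam
    rw [List.perm_ext_iff_of_nodup (List.nodup_reverse.mpr List.nodup_range)]
    · intro i
      simp only [List.mem_reverse, List.mem_range, List.mem_append, List.mem_filter,
        decide_eq_true_eq]
      have := hk i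
      tauto
    · refine hL.append (List.nodup_range.filter _) ?_
      intro i hi hi'
      simp only [List.mem_filter, decide_eq_true_eq] at hi'
      exact hi'.2 hi
  · intro i hi
    simp only [List.mem_filter, decide_eq_true_eq] at hi
    by_contra h
    exact hi.2 (hd i (Finsupp.mem_support_iff.mpr h))

theorem chainCount_map (s : ℕ → ℕ) (L : List ℕ) (τ : Bool) (e : ℕ → ℕ) :
    chainCount (L.map s) (fun _ => τ) e = chainCount L (fun _ => τ) (e ∘ s) := by
  induction L with
  | nil => rfl
  | cons i L ih => rw [List.map_cons, chainCount_cons, chainCount_cons, ih, Function.comp_apply]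

/-- This is the symmetry of Schur functions: relabelling the entries leaves the sequence of strip
sizes unchanged, and their order does not matter. -/
theorem kostka_mapDomain (s : Equiv.Perm ℕ) (d : ℕ →₀ ℕ) (lam : YoungDiagram) :
    kostka lam (d.mapDomain s) = kostka lam d := by
  have h1 := kostka_eq_chainCount (L := d.support.toList) (d := d) (Finset.nodup_toList _)
    (fun i hi => Finset.mem_toList.mpr hi) lam
  have h2 := kostka_eq_chainCount (L := d.support.toList.map s) (d := d.mapDomain s)
    ((Finset.nodup_toList _).map s.injective) (fun i hi => by
      have := Finsupp.mapDomain_support hi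
      simpa using this) lam
  have h3 : (d.mapDomain s : ℕ → ℕ) ∘ s = d := by
    funext i
    exact Finsupp.mapDomain_apply s.injective d i
  rw [chainCount_map, h3, ← h1] at h2
  exact_mod_cast h2

/-! ### Symmetric series have Schur expansions -/

/-- The finite set of diagrams with `n` cells. -/
noncomputable def diagrams (n : ℕ) : Finset YoungDiagram := (finite_card_eq n).toFinset

theorem mem_diagrams {n : ℕ} {lam : YoungDiagram} : lam ∈ diagrams n ↔ lam.card = n := by
  simp [diagrams]

open scoped MvPowerSeries.WithPiTopology in
theorem HasSchurExpansion.coeff_eq {f : Series} {c : YoungDiagram → ℝ} (h : HasSchurExpansion f c)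
    (d : ℕ →₀ ℕ) :
    MvPowerSeries.coeff d f = ∑ lam ∈ diagrams d.degree, c lam * kostka lam d := by
  have h1 := MvPowerSeries.WithPiTopology.hasSum_iff_hasSum_coeff.mp h d
  refine h1.unique (hasSum_sum_of_ne_finset_zero fun lam hlam => ?_)
  change c lam * (kostka lam d : ℝ) = 0
  by_contra h0
  exact hlam (mem_diagrams.mpr
    (card_eq_of_kostka_ne_zero (by exact_mod_cast (mul_ne_zero_iff.mp h0).2)))

theorem degree_rowContent (μ : YoungDiagram) : (rowContent μ).degree = μ.card :=
  (card_eq_of_kostka_ne_zero (kostka_self_ne_zero μ)).symm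

/-- The system is triangular with nonzero diagonal: besides `μ`, only diagrams with a smaller sum
`r` of row indices occur in the equation for `μ`. It is solved by well-founded recursion on `r`. -/
theorem exists_schurCoeff (a : YoungDiagram → ℝ) : ∃ c : YoungDiagram → ℝ,
    ∀ μ, ∑ lam ∈ diagrams μ.card, c lam * kostka lam (rowContent μ) = a μ := by
  classical
  let r : YoungDiagram → ℕ := fun μ => ∑ x ∈ μ.cells, x.1
  let F : (μ : YoungDiagram) → ((lam : YoungDiagram) → r lam < r μ → ℝ) → ℝ := fun μ ih =>
    (a μ - ∑ lam ∈ diagrams μ.card,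
      if h : r lam < r μ then ih lam h * kostka lam (rowContent μ) else 0) /
        kostka μ (rowContent μ)
  let c : YoungDiagram → ℝ := (measure r).wf.fix F
  have hc : ∀ μ, c μ = (a μ - ∑ lam ∈ diagrams μ.card,
      if r lam < r μ then c lam * kostka lam (rowContent μ) else 0) /
        kostka μ (rowContent μ) := by
    intro μ
    exact (measure r).wf.fix_eq F μ
  refine ⟨c, fun μ => ?_⟩
  have h0 : (kostka μ (rowContent μ) : ℝ) ≠ 0 := by exact_mod_cast kostka_self_ne_zero μ
  have h1 : ∀ lam ∈ diagrams μ.card, c lam * kostka lam (rowContent μ) =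
      (if r lam < r μ then c lam * kostka lam (rowContent μ) else 0) +
        if lam = μ then c μ * kostka μ (rowContent μ) else 0 := by
    intro lam _
    by_cases he : lam = μ
    · subst he; simp
    · rw [if_neg he, add_zero]
      split_ifs with h
      · rfl
      · by_contra hne
        have h2 := (mul_ne_zero_iff.mp hne).2
        rcases eq_or_lt_of_kostka_ne_zero (by exact_mod_cast h2) with h3 | h3
        · exact he h3
        · exact h h3
  rw [Finset.sum_congr rfl h1, Finset.sum_add_distrib, Finset.sum_ite_eq',
    if_pos (mem_diagrams.mpr rfl), hc μ, div_mul_cancel₀ _ h0]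
  ring

/-- Sort the exponents: swapping an adjacent ascent lowers `∑ i * d i`, and an exponent without
ascents is the `rowContent` of a diagram. -/
theorem eq_zero_of_eq_zero_rowContent {G : (ℕ →₀ ℕ) → ℝ}
    (hG : ∀ i j d, G (d.mapDomain (Equiv.swap i j)) = G d) (h0 : ∀ μ, G (rowContent μ) = 0)
    (d : ℕ →₀ ℕ) : G d = 0 := by
  induction hn : Finsupp.weight id d using Nat.strong_induction_on generalizing d with
  | _ n ih =>
    subst hn
    by_cases hd : Antitone d
    · obtain ⟨N, hN⟩ := Infinite.exists_notMem_finset d.support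
      obtain ⟨μ, hμ⟩ := exists_rowLen_eq hd (Finsupp.notMem_support_iff.mp hN)
      have : d = rowContent μ := by
        ext i
        exact (hμ i).symm
      rw [this, h0]
    · obtain ⟨i, hi⟩ : ∃ i, d i < d (i + 1) := by
        by_contra! h
        exact hd (antitone_nat_of_succ_le h)
      obtain ⟨e, he1, he2, hde⟩ : ∃ e : ℕ →₀ ℕ, e i = 0 ∧ e (i + 1) = 0 ∧
          d = e + Finsupp.single i (d i) + Finsupp.single (i + 1) (d (i + 1)) := by
        refine ⟨(d.erase i).erase (i + 1), ?_, ?_, ?_⟩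
        · rw [Finsupp.erase_ne (by omega), Finsupp.erase_same]
        · rw [Finsupp.erase_same]
        · ext k
          by_cases h1 : k = i
          · subst h1
            simp
          · by_cases h2 : k = i + 1
            · subst h2
              simp
            · simp [Finsupp.erase_ne h1, Finsupp.erase_ne h2, Ne.symm h1,
                Ne.symm h2]
      have hswap : e.mapDomain (Equiv.swap i (i + 1)) = e := by
        conv_rhs => rw [← Finsupp.mapDomain_id (v := e)]
        refine Finsupp.mapDomain_congr fun k hk => ?_
        rw [Finsupp.mem_support_iff] at hk
        refine Equiv.swap_apply_of_ne_of_ne ?_ ?_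
        · rintro rfl; exact hk he1
        · rintro rfl; exact hk he2
      rw [← hG i (i + 1)]
      refine ih _ ?_ _ rfl
      generalize d i = a at hi hde
      generalize d (i + 1) = b at hi hde
      subst hde
      rw [Finsupp.mapDomain_add, Finsupp.mapDomain_add, Finsupp.mapDomain_single,
        Finsupp.mapDomain_single, hswap, Equiv.swap_apply_left, Equiv.swap_apply_right]
      simp only [map_add, Finsupp.weight_single, id, smul_eq_mul]
      nlinarith

-- Choose `c` so that the coefficients at all `rowContent μ` are right. The difference of `f` and
-- the Schur sum is symmetric, so it vanishes at every exponent.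
open scoped MvPowerSeries.WithPiTopology in
theorem exists_hasSchurExpansion {f : Series}
    (hf : ∀ i j d, MvPowerSeries.coeff (d.mapDomain (Equiv.swap i j)) f =
      MvPowerSeries.coeff d f) : ∃ c, HasSchurExpansion f c := by
  obtain ⟨c, hc⟩ := exists_schurCoeff fun μ => MvPowerSeries.coeff (rowContent μ) f
  refine ⟨c, ?_⟩
  have hs : HasSchurExpansion _ c := (summable_schur c).hasSum
  suffices h : f = ∑' lam, c lam • schur lam by
    rw [← h] at hs
    exact hs
  ext d
  rw [hs.coeff_eq, ← sub_eq_zero]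
  refine eq_zero_of_eq_zero_rowContent (G := fun d => MvPowerSeries.coeff d f -
    ∑ lam ∈ diagrams d.degree, c lam * kostka lam d) ?_ ?_ d
  · intro i j d
    simp only [hf, kostka_mapDomain, Finsupp.degree_mapDomain]
  · intro μ
    simp only [degree_rowContent]
    rw [hc, sub_self]

open MvPowerSeries (X coeff constantCoeff)

/-! ### Linear substitutions of the variables -/

/-- The substitution `x_i ↦ a_i x_{f i}`. -/
noncomputable def linSubst (f : ℕ → ℕ) [Filter.TendstoCofinite f] (a : ℕ → ℝ) :
    Series →ₐ[ℝ] Series :=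
  (MvPowerSeries.rename f).comp (MvPowerSeries.rescaleAlgHom a)

section

variable (f : ℕ → ℕ) [Filter.TendstoCofinite f] (a : ℕ → ℝ)

theorem linSubst_X (i : ℕ) : linSubst f a (X i) = a i • X (f i) := by
  rw [linSubst, AlgHom.comp_apply, MvPowerSeries.rescaleAlgHom, MvPowerSeries.substAlgHom_X,
    Pi.smul_apply', map_smul, MvPowerSeries.rename_X]

theorem linSubst_subst (p : PowerSeries ℝ) (i : ℕ) :
    linSubst f a (p.subst (X i : Series)) = p.subst (a i • X (f i) : Series) := by
  have h : ∀ g : Series, linSubst f a g =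
      MvPowerSeries.subst (X ∘ f : ℕ → Series) (MvPowerSeries.subst (a • X : ℕ → Series) g) := by
    intro g
    rw [linSubst, AlgHom.comp_apply, MvPowerSeries.rescaleAlgHom_apply,
      MvPowerSeries.rescale_eq_subst, MvPowerSeries.rename_eq_subst]
  have h1 : MvPowerSeries.HasSubst (fun _ : Unit => (X i : Series)) :=
    (PowerSeries.HasSubst.X i).const
  have h2 := h1.comp (MvPowerSeries.HasSubst.smul_X a)
  simp only [MvPowerSeries.coe_substAlgHom] at h2
  rw [PowerSeries.subst_def, PowerSeries.subst_def, h,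
    MvPowerSeries.subst_comp_subst_apply h1 (MvPowerSeries.HasSubst.smul_X a),
    MvPowerSeries.subst_comp_subst_apply h2
      (MvPowerSeries.HasSubst.X_comp f)]
  congr 1
  funext _
  rw [← h, linSubst_X]

theorem coeff_linSubst_id (F : Series) (d : ℕ →₀ ℕ) :
    coeff d (linSubst id a F) = (d.prod fun i n => a i ^ n) * coeff d F := by
  rw [linSubst, AlgHom.comp_apply, MvPowerSeries.rename_id_apply,
    MvPowerSeries.rescaleAlgHom_apply, MvPowerSeries.coeff_rescale]

theorem linSubst_inv (u : Series) (hu : constantCoeff u ≠ 0)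
    (hu' : constantCoeff (linSubst f a u) ≠ 0) : linSubst f a u⁻¹ = (linSubst f a u)⁻¹ := by
  rw [MvPowerSeries.eq_inv_iff_mul_eq_one hu', ← map_mul, MvPowerSeries.inv_mul_cancel _ hu,
    map_one]

end

theorem coeff_linSubst_perm (s : Equiv.Perm ℕ) (F : Series) (d : ℕ →₀ ℕ) :
    coeff (d.mapDomain s) (linSubst s 1 F) = coeff d F := by
  have h : MvPowerSeries.rescaleAlgHom (1 : ℕ → ℝ) F = F := by
    rw [MvPowerSeries.rescaleAlgHom_one]; rfl
  rw [linSubst, AlgHom.comp_apply, h]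
  have := MvPowerSeries.coeff_embDomain_rename s.toEmbedding F d
  rw [Finsupp.embDomain_eq_mapDomain] at this
  exact this

instance tendstoCofinite_update (k k' : ℕ) : Filter.TendstoCofinite (Function.update id k' k) := by
  rw [Filter.tendstoCofinite_iff_finite_preimage_singleton]
  intro b
  refine (Set.toFinite {b, k'}).subset ?_
  intro x hx
  by_cases h : x = k'
  · exact Or.inr h
  · left
    simpa [Function.update_of_ne h] using hx

/-- Substituting `-x_k` for `x_k` and `x_k` for `x_{k'}`. -/
theorem coeff_linSubst_update {k k' : ℕ} (hk : k ≠ k') (F : Series) {e : ℕ →₀ ℕ}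
    (he : e k = 0) (he' : e k' = 0) (n : ℕ) :
    coeff (e + Finsupp.single k n)
      (linSubst (Function.update id k' k) (Function.update 1 k (-1)) F) =
      ∑ j ∈ Finset.range (n + 1), (-1) ^ j *
        coeff (e + Finsupp.single k j + Finsupp.single k' (n - j)) F := by
  have hdec : ∀ x : ℕ →₀ ℕ, ∃ y : ℕ →₀ ℕ, y k = 0 ∧ y k' = 0 ∧
      x = y + Finsupp.single k (x k) + Finsupp.single k' (x k') := by
    intro x
    refine ⟨(x.erase k).erase k', ?_, ?_, ?_⟩
    · rw [Finsupp.erase_ne hk, Finsupp.erase_same]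
    · rw [Finsupp.erase_same]
    · ext i
      by_cases h1 : i = k
      · subst h1
        simp [hk]
      · by_cases h2 : i = k'
        · subst h2
          simp [hk]
        · simp [Finsupp.erase_ne h1, Finsupp.erase_ne h2, Ne.symm h1, Ne.symm h2]
  have hmap : ∀ (y : ℕ →₀ ℕ) (a b : ℕ), y k' = 0 →
      (y + Finsupp.single k a + Finsupp.single k' b).mapDomain (Function.update id k' k) =
        y + Finsupp.single k (a + b) := by
    intro y a b hy
    have : y.mapDomain (Function.update id k' k) = y := by
      conv_rhs => rw [← Finsupp.mapDomain_id (v := y)]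
      refine Finsupp.mapDomain_congr fun i hi => ?_
      rw [Finsupp.mem_support_iff] at hi
      rw [Function.update_of_ne]
      rintro rfl
      exact hi hy
    rw [Finsupp.mapDomain_add, Finsupp.mapDomain_add, this, Finsupp.mapDomain_single,
      Finsupp.mapDomain_single, Function.update_self, Function.update_of_ne hk, id,
      Finsupp.single_add, add_assoc]
  rw [linSubst, AlgHom.comp_apply, MvPowerSeries.coeff_rename]
  symm
  refine Finset.sum_bij (fun j _ => e + Finsupp.single k j + Finsupp.single k' (n - j)) ?_ ?_ ?_ ?_
  · intro j hj
    rw [Set.Finite.mem_toFinset, Set.mem_preimage, Set.mem_singleton_iff, hmap _ _ _ he']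
    rw [Finset.mem_range] at hj
    rw [Nat.add_sub_cancel' (by omega)]
  · intro i hi j hj h
    have := DFunLike.congr_fun h k
    simpa [hk, he] using this
  · intro x hx
    rw [Set.Finite.mem_toFinset, Set.mem_preimage, Set.mem_singleton_iff] at hx
    obtain ⟨y, hy, hy', hxy⟩ := hdec x
    generalize x k = a at hxy
    generalize x k' = b at hxy
    subst hxy
    rw [hmap _ _ _ hy'] at hx
    have h1 : a + b = n := by
      have := DFunLike.congr_fun hx k
      simpa [hy, he] using this
    rw [h1] at hx
    have h2 : y = e := add_right_cancel hx
    refine ⟨a, Finset.mem_range.mpr (by omega), ?_⟩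
    rw [← h2, ← h1, Nat.add_sub_cancel_left]
  · intro j hj
    rw [MvPowerSeries.rescaleAlgHom_apply, MvPowerSeries.coeff_rescale]
    congr 1
    rw [Finsupp.prod, Finset.prod_eq_single k]
    · simp [hk, he]
    · intro i _ hi
      simp [Function.update_of_ne hi]
    · intro h
      rw [Finsupp.notMem_support_iff] at h
      rw [h, pow_zero]

/-! ### The dual of a series in one variable -/

theorem constantCoeff_rescale (a : ℝ) (p : PowerSeries ℝ) :
    (PowerSeries.rescale a p).constantCoeff = p.constantCoeff := by
  rw [← PowerSeries.coeff_zero_eq_constantCoeff_apply, PowerSeries.coeff_rescale, pow_zero, one_mul,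
    PowerSeries.coeff_zero_eq_constantCoeff_apply]

theorem constantCoeff_dualSeries {p : PowerSeries ℝ} (hp : p.constantCoeff = 1) :
    (dualSeries p).constantCoeff = 1 := by
  simp [dualSeries, hp, constantCoeff_rescale]

theorem dualSeries_mul {p : PowerSeries ℝ} (hp : p.constantCoeff = 1) :
    dualSeries p * ((1 - PowerSeries.X ^ 2) * PowerSeries.rescale (-1) p) = 1 :=
  PowerSeries.inv_mul_cancel _ (by simp [hp, constantCoeff_rescale])

theorem rescale_neg_one_rescale (p : PowerSeries ℝ) :
    PowerSeries.rescale (-1) (PowerSeries.rescale (-1) p) = p := by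
  rw [PowerSeries.rescale_rescale]
  norm_num

theorem rescale_dualSeries_mul {p : PowerSeries ℝ} (hp : p.constantCoeff = 1) :
    PowerSeries.rescale (-1) (dualSeries p) * ((1 - PowerSeries.X ^ 2) * p) = 1 := by
  have h := congrArg (PowerSeries.rescale (-1)) (dualSeries_mul hp)
  rw [map_mul, map_mul, rescale_neg_one_rescale, map_sub, map_pow, map_one,
    PowerSeries.rescale_X] at h
  simpa using h

theorem eq_dualSeries_of_mul {p q : PowerSeries ℝ} (hp : p.constantCoeff = 1)
    (h : q * ((1 - PowerSeries.X ^ 2) * PowerSeries.rescale (-1) p) = 1) : q = dualSeries p := by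
  rwa [dualSeries, PowerSeries.eq_inv_iff_mul_eq_one (by simp [hp, constantCoeff_rescale])]

theorem dualSeries_dualSeries {p : PowerSeries ℝ} (hp : p.constantCoeff = 1) :
    dualSeries (dualSeries p) = p := by
  refine (eq_dualSeries_of_mul (constantCoeff_dualSeries hp) ?_).symm
  linear_combination rescale_dualSeries_mul hp

/-! ### Finite products with two kinds of variables -/

/-- The factor of a pair of variables with product `u`. -/
noncomputable def pairFactor (v w : Bool) (u : Series) : Series :=
  if v = w then (1 - u)⁻¹ else 1 + u

/-- The factor of one variable `u`. -/
noncomputable def varFactor (p : PowerSeries ℝ) (v : Bool) (u : Series) : Series :=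
  (if v then dualSeries p else p).subst u

/-- The image of `κ_p` under `ω` in the variables `x_i` with `τ i`, in the finitely many variables
`x_i` with `i ∈ S`. -/
noncomputable def kernelProd (p : PowerSeries ℝ) (τ : ℕ → Bool) (S : Finset ℕ) : Series :=
  ∏ j ∈ S, (varFactor p (τ j) (X j) *
    ∏ i ∈ S with i < j, pairFactor (τ i) (τ j) (X i * X j))

theorem pairFactor_comm (v w : Bool) (u : Series) : pairFactor v w u = pairFactor w v u := by
  rw [pairFactor, pairFactor]
  simp only [eq_comm]

theorem pairFactor_zero (v w : Bool) : pairFactor v w 0 = 1 := by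
  have h : (1 : Series)⁻¹ = 1 := by
    rw [eq_comm, MvPowerSeries.eq_inv_iff_mul_eq_one (by simp), one_mul]
  rw [pairFactor]
  split_ifs <;> simp [h]

/-- Relative to any third variable, of either kind `w`, an ordinary variable and its negative taken
as a dual one cancel. -/
theorem pairFactor_neg_mul (w : Bool) {u : Series} (hu : constantCoeff u = 0) :
    pairFactor false w u * pairFactor true w (-u) = 1 := by
  cases w
  · rw [pairFactor, pairFactor, if_pos rfl, if_neg (by simp), ← sub_eq_add_neg]
    exact MvPowerSeries.inv_mul_cancel _ (by simp [hu])
  · rw [pairFactor, pairFactor, if_neg (by simp), if_pos rfl, sub_neg_eq_add]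
    exact MvPowerSeries.mul_inv_cancel _ (by simp [hu])

theorem varFactor_zero {p : PowerSeries ℝ} (hp : p.constantCoeff = 1) (v : Bool) :
    varFactor p v 0 = 1 := by
  rw [varFactor, PowerSeries.subst_zero_eq_C_constantCoeff]
  cases v <;> simp [hp, constantCoeff_dualSeries]

theorem subst_rescale_neg_one (p : PowerSeries ℝ) (k : ℕ) :
    (PowerSeries.rescale (-1) p).subst (X k : Series) = p.subst (-X k : Series) := by
  rw [PowerSeries.rescale_eq_subst, PowerSeries.subst_comp_subst_apply
    (PowerSeries.HasSubst.smul_X' _) (PowerSeries.HasSubst.X k),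
    PowerSeries.subst_smul (PowerSeries.HasSubst.X k),
    PowerSeries.subst_X (PowerSeries.HasSubst.X k), neg_one_smul]

/-- The factor `1 - x_k²` is what the mutual pair factor of the two cancelling variables becomes; it
is the origin of `1 - x²` in the definition of `p*`. -/
theorem varFactor_neg_mul {p : PowerSeries ℝ} (hp : p.constantCoeff = 1) (k : ℕ) :
    varFactor p true (-X k) * ((1 - X k * X k) * varFactor p false (X k)) = 1 := by
  have hX : PowerSeries.HasSubst (X k : Series) := PowerSeries.HasSubst.X k
  have h := congrArg (PowerSeries.substAlgHom (R := ℝ) hX) (rescale_dualSeries_mul hp)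
  rw [map_mul, map_mul, map_sub, map_pow, map_one, PowerSeries.substAlgHom_X,
    PowerSeries.coe_substAlgHom, subst_rescale_neg_one] at h
  simpa [varFactor, pow_two] using h

/-- Pair factors are symmetric, so a variable can be split off whatever its position in the order of
the indices. -/
theorem kernelProd_insert (p : PowerSeries ℝ) (τ : ℕ → Bool) {S : Finset ℕ} {k : ℕ} (hk : k ∉ S) :
    kernelProd p τ (insert k S) = kernelProd p τ S *
      (varFactor p (τ k) (X k) * ∏ j ∈ S, pairFactor (τ k) (τ j) (X k * X j)) := by
  have h1 : ∀ j ∈ S, ∏ i ∈ insert k S with i < j, pairFactor (τ i) (τ j) (X i * X j) =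
      (∏ i ∈ S with i < j, pairFactor (τ i) (τ j) (X i * X j)) *
        if k < j then pairFactor (τ k) (τ j) (X k * X j) else 1 := by
    intro j _
    rw [Finset.filter_insert]
    split_ifs with h
    · rw [Finset.prod_insert (fun h' => hk (Finset.mem_filter.mp h').1), mul_comm]
    · rw [mul_one]
  have h2 : ∏ i ∈ insert k S with i < k, pairFactor (τ i) (τ k) (X i * X k) =
      ∏ j ∈ S, if j < k then pairFactor (τ k) (τ j) (X k * X j) else 1 := by
    rw [Finset.filter_insert, if_neg (lt_irrefl k), Finset.prod_filter]
    refine Finset.prod_congr rfl fun j _ => ?_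
    rw [pairFactor_comm, mul_comm]
  have h4 : ∏ j ∈ S, (varFactor p (τ j) (X j) *
      ∏ i ∈ insert k S with i < j, pairFactor (τ i) (τ j) (X i * X j)) = kernelProd p τ S *
        ∏ j ∈ S, if k < j then pairFactor (τ k) (τ j) (X k * X j) else 1 := by
    rw [kernelProd, ← Finset.prod_mul_distrib]
    refine Finset.prod_congr rfl fun j hj => ?_
    rw [h1 j hj, mul_assoc]
  rw [kernelProd, Finset.prod_insert hk, h2, h4]
  have h3 : ∏ j ∈ S, pairFactor (τ k) (τ j) (X k * X j) =
      (∏ j ∈ S, if k < j then pairFactor (τ k) (τ j) (X k * X j) else 1) *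
        ∏ j ∈ S, if j < k then pairFactor (τ k) (τ j) (X k * X j) else 1 := by
    rw [← Finset.prod_mul_distrib]
    refine Finset.prod_congr rfl fun j hj => ?_
    have hne : k ≠ j := fun h => hk (h ▸ hj)
    rcases lt_or_gt_of_ne hne with h | h
    · rw [if_pos h, if_neg h.not_gt, mul_one]
    · rw [if_neg h.not_gt, if_pos h, one_mul]
  rw [h3]
  ring

section

variable (f : ℕ → ℕ) [Filter.TendstoCofinite f] (a : ℕ → ℝ)

theorem linSubst_varFactor (p : PowerSeries ℝ) (v : Bool) (i : ℕ) :
    linSubst f a (varFactor p v (X i)) = varFactor p v (a i • X (f i)) :=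
  linSubst_subst f a _ i

theorem linSubst_pairFactor (v w : Bool) (i j : ℕ) :
    linSubst f a (pairFactor v w (X i * X j)) =
      pairFactor v w ((a i • X (f i)) * (a j • X (f j))) := by
  have h : linSubst f a (X i * X j) = (a i • X (f i)) * (a j • X (f j)) := by
    rw [map_mul, linSubst_X, linSubst_X]
  rw [pairFactor, pairFactor]
  split_ifs
  · rw [linSubst_inv, map_sub, map_one, h]
    · simp
    · rw [map_sub, map_one, h]
      simp
  · rw [map_add, map_one, h]

theorem linSubst_kernelProd (p : PowerSeries ℝ) (τ : ℕ → Bool) {S : Finset ℕ}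
    (hf : ∀ i ∈ S, f i = i) (ha : ∀ i ∈ S, a i = 1) :
    linSubst f a (kernelProd p τ S) = kernelProd p τ S := by
  rw [kernelProd, map_prod]
  refine Finset.prod_congr rfl fun j hj => ?_
  rw [map_mul, map_prod, linSubst_varFactor, hf j hj, ha j hj, one_smul]
  congr 1
  refine Finset.prod_congr rfl fun i hi => ?_
  have hi := (Finset.mem_filter.mp hi).1
  rw [linSubst_pairFactor, hf j hj, ha j hj, hf i hi, ha i hi, one_smul, one_smul]

end

theorem prod_update_pow {k : ℕ} {d : ℕ →₀ ℕ} (hd : d k = 0) :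
    (d.prod fun i n => (Function.update 1 k 0 : ℕ → ℝ) i ^ n) = 1 := by
  refine Finset.prod_eq_one fun i _ => ?_
  by_cases h : i = k
  · subst h
    simp [hd]
  · simp [Function.update_of_ne h]

/-- Setting `x_k = 0` turns all factors that involve `x_k` into `1` and does not affect coefficients
of monomials without `x_k`. -/
theorem coeff_kernelProd_insert {p : PowerSeries ℝ} (hp : p.constantCoeff = 1) (τ : ℕ → Bool)
    (S : Finset ℕ) {k : ℕ} {d : ℕ →₀ ℕ} (hd : d k = 0) :
    coeff d (kernelProd p τ (insert k S)) = coeff d (kernelProd p τ S) := by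
  by_cases hk : k ∈ S
  · rw [Finset.insert_eq_of_mem hk]
  have h : ∀ F : Series, coeff d F = coeff d (linSubst id (Function.update 1 k 0) F) := by
    intro F
    rw [coeff_linSubst_id, prod_update_pow hd, one_mul]
  have h' : linSubst id (Function.update 1 k 0) (kernelProd p τ (insert k S)) =
      linSubst id (Function.update 1 k 0) (kernelProd p τ S) := by
    rw [kernelProd_insert p τ hk]
    simp only [map_mul, map_prod, linSubst_varFactor, linSubst_pairFactor, Function.update_self,
      zero_smul, zero_mul, pairFactor_zero, Finset.prod_const_one, varFactor_zero hp, mul_one]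
  rw [h, h', ← h]

theorem coeff_kernelProd_of_subset {p : PowerSeries ℝ} (hp : p.constantCoeff = 1) (τ : ℕ → Bool)
    {S T : Finset ℕ} (hST : S ⊆ T) {d : ℕ →₀ ℕ} (hd : d.support ⊆ S) :
    coeff d (kernelProd p τ T) = coeff d (kernelProd p τ S) := by
  have key : ∀ U : Finset ℕ, coeff d (kernelProd p τ (U ∪ S)) = coeff d (kernelProd p τ S) := by
    intro U
    induction U using Finset.induction_on with
    | empty => rw [Finset.empty_union]
    | insert a U _ ih =>
      rw [Finset.insert_union]
      by_cases ha : a ∈ S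
      · rw [Finset.insert_eq_of_mem (Finset.mem_union_right _ ha), ih]
      · rw [coeff_kernelProd_insert hp τ _ (Finsupp.notMem_support_iff.mp fun h => ha (hd h)), ih]
  rw [← key T, Finset.union_eq_left.mpr hST]

theorem kernelProd_congr (p : PowerSeries ℝ) {τ τ' : ℕ → Bool} {S : Finset ℕ}
    (h : ∀ i ∈ S, τ i = τ' i) : kernelProd p τ S = kernelProd p τ' S := by
  refine Finset.prod_congr rfl fun j hj => ?_
  rw [h j hj]
  congr 1
  refine Finset.prod_congr rfl fun i hi => ?_
  rw [h i (Finset.mem_filter.mp hi).1]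

/-- Two adjacent variables of different kinds cancel if one is the negative of the other. -/
theorem sum_coeff_kernelProd {p : PowerSeries ℝ} (hp : p.constantCoeff = 1) {τ : ℕ → Bool}
    {S : Finset ℕ} {k k' : ℕ} (hkk : k ≠ k') (hk : k ∉ S) (hk' : k' ∉ S) (hτ : τ k = true)
    (hτ' : τ k' = false) {e : ℕ →₀ ℕ} (he : e k = 0) (he' : e k' = 0) {n : ℕ} (hn : 0 < n) :
    ∑ j ∈ Finset.range (n + 1), (-1) ^ j *
      coeff (e + Finsupp.single k j + Finsupp.single k' (n - j))
        (kernelProd p τ (insert k (insert k' S))) = 0 := by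
  rw [← coeff_linSubst_update hkk _ he he']
  have hkS : k ∉ insert k' S := by
    rw [Finset.mem_insert]
    tauto
  have hne : ∀ j ∈ S, j ≠ k ∧ j ≠ k' := fun j hj => ⟨fun h => hk (h ▸ hj), fun h => hk' (h ▸ hj)⟩
  have h1 : linSubst (Function.update id k' k) (Function.update 1 k (-1))
      (kernelProd p τ (insert k (insert k' S))) = kernelProd p τ S := by
    rw [kernelProd_insert p τ hkS, kernelProd_insert p τ hk', Finset.prod_insert hk']
    simp only [map_mul, map_prod, linSubst_varFactor, linSubst_pairFactor, Function.update_self,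
      Function.update_of_ne hkk, Function.update_of_ne hkk.symm, Pi.one_apply, one_smul, id,
      neg_one_smul, hτ, hτ']
    rw [linSubst_kernelProd]
    · have h2 : (∏ j ∈ S, pairFactor false (τ j)
          (X k * ((Function.update 1 k (-1) : ℕ → ℝ) j • X (Function.update id k' k j)))) *
          (∏ j ∈ S, pairFactor true (τ j)
          (-X k * ((Function.update 1 k (-1) : ℕ → ℝ) j • X (Function.update id k' k j)))) = 1 := by
        rw [← Finset.prod_mul_distrib]
        refine Finset.prod_eq_one fun j hj => ?_
        rw [Function.update_of_ne (hne j hj).1, Function.update_of_ne (hne j hj).2, Pi.one_apply,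
          one_smul, neg_mul]
        exact pairFactor_neg_mul _ (by simp)
      have h3 := varFactor_neg_mul hp k
      have h4 : pairFactor true false (-X k * X k) = 1 - X k * X k := by
        rw [pairFactor, if_neg (by simp), neg_mul, sub_eq_add_neg]
      rw [h4]
      linear_combination (kernelProd p τ S) * h2 + (kernelProd p τ S) * (∏ j ∈ S, pairFactor false
        (τ j) (X k * ((Function.update 1 k (-1) : ℕ → ℝ) j • X (Function.update id k' k j)))) *
          (∏ j ∈ S, pairFactor true (τ j) (-X k * ((Function.update 1 k (-1) : ℕ → ℝ) j •
            X (Function.update id k' k j)))) * h3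
    · exact fun i hi => Function.update_of_ne (hne i hi).2 _ _
    · exact fun i hi => Function.update_of_ne (hne i hi).1 _ _
  -- What remains after the cancellation does not involve `x_k`: it is fixed by `x_k ↦ 0`. Its
  -- coefficients at monomials with `x_k ^ n`, `n > 0`, therefore vanish.
  have h2 : kernelProd p τ S = linSubst id (Function.update 1 k 0) (kernelProd p τ S) :=
    (linSubst_kernelProd id (Function.update 1 k 0) p τ (fun _ _ => rfl)
      fun i hi => Function.update_of_ne (hne i hi).1 _ _).symm
  rw [h1, h2, coeff_linSubst_id, Finsupp.prod, Finset.prod_eq_zero (i := k), zero_mul]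
  · rw [Finsupp.mem_support_iff, Finsupp.add_apply, he, Finsupp.single_eq_same]
    omega
  · rw [Finsupp.add_apply, he, Finsupp.single_eq_same, Function.update_self, zero_pow (by omega)]

/-! ### Reduction of `κ_p` to finitely many variables -/

-- A rescaling multiplies each coefficient by a constant, so it passes to the limit coefficient by
-- coefficient; from `S` on, the rescaled partial products are constant.
open scoped MvPowerSeries.WithPiTopology in
theorem linSubst_tprod (a : ℕ → ℝ) {g : ℕ → Series} (hg : Multipliable g) {S : Finset ℕ}
    (h : ∀ j ∉ S, linSubst id a (g j) = 1) :
    linSubst id a (∏' j, g j) = linSubst id a (∏ j ∈ S, g j) := by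
  ext d
  have h1 := ((MvPowerSeries.WithPiTopology.continuous_coeff ℝ d).tendsto _).comp hg.hasProd
  have h2 := h1.const_mul (d.prod fun i n => a i ^ n)
  rw [coeff_linSubst_id]
  refine tendsto_nhds_unique h2 (tendsto_const_nhds.congr' ?_)
  filter_upwards [Filter.eventually_ge_atTop S] with T hT
  rw [Function.comp_apply, ← coeff_linSubst_id, map_prod (linSubst id a),
    map_prod (linSubst id a)]
  exact congrArg (coeff d) (Finset.prod_subset hT fun j _ hj => h j hj)

open scoped MvPowerSeries.WithPiTopology in
theorem coeff_kappa_range {p : PowerSeries ℝ} (hp : p.constantCoeff = 1) (n : ℕ) {d : ℕ →₀ ℕ}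
    (hd : d.support ⊆ Finset.range n) :
    coeff d (kappa p) = coeff d (kernelProd p (fun _ => false) (Finset.range n)) := by
  -- Setting the variables from `x_n` on to zero keeps the coefficient at `d` and makes both
  -- infinite products finite.
  let a : ℕ → ℝ := fun i => if i < n then 1 else 0
  have ha : ∀ i ∈ Finset.range n, a i = 1 := fun i hi => if_pos (Finset.mem_range.mp hi)
  have ha' : ∀ i ∉ Finset.range n, a i = 0 := fun i hi => if_neg (mt Finset.mem_range.mpr hi)
  have hcoeff : ∀ F : Series, coeff d F = coeff d (linSubst id a F) := by
    intro F
    rw [coeff_linSubst_id, Finsupp.prod, Finset.prod_eq_one, one_mul]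
    intro i hi
    rw [ha i (hd hi), one_pow]
  have h1 : linSubst id a (∏' i, p.subst (X i : Series)) =
      ∏ i ∈ Finset.range n, p.subst (X i : Series) := by
    rw [linSubst_tprod a (multipliable_subst_X p hp) (S := Finset.range n), map_prod]
    · refine Finset.prod_congr rfl fun i hi => ?_
      rw [linSubst_subst, ha i hi, one_smul, id]
    · intro j hj
      rw [linSubst_subst, ha' j hj, zero_smul, PowerSeries.subst_zero_eq_C_constantCoeff, hp,
        map_one, map_one]
  have h2 : linSubst id a (∏' j, ∏ i ∈ Finset.range j, (1 - X i * X j : Series)) =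
      ∏ j ∈ Finset.range n, ∏ i ∈ Finset.range j, (1 - X i * X j : Series) := by
    rw [linSubst_tprod a multipliable_one_sub_mul (S := Finset.range n), map_prod]
    · refine Finset.prod_congr rfl fun j hj => ?_
      rw [map_prod]
      refine Finset.prod_congr rfl fun i hi => ?_
      have hi' : i ∈ Finset.range n := by
        rw [Finset.mem_range] at hi hj ⊢
        omega
      rw [map_sub, map_one, map_mul, linSubst_X, linSubst_X, ha i hi', ha j hj, one_smul,
        one_smul, id, id]
    · intro j hj
      rw [map_prod]
      refine Finset.prod_eq_one fun i _ => ?_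
      rw [map_sub, map_one, map_mul, linSubst_X, linSubst_X, ha' j hj, zero_smul, mul_zero,
        sub_zero]
  have h3 : constantCoeff (∏ j ∈ Finset.range n, ∏ i ∈ Finset.range j,
      (1 - X i * X j : Series)) = 1 := by
    simp [map_prod]
  have h4 : constantCoeff (∏' j, ∏ i ∈ Finset.range j, (1 - X i * X j : Series)) = 1 := by
    rw [← h3, ← h2, ← MvPowerSeries.coeff_zero_eq_constantCoeff_apply,
      ← MvPowerSeries.coeff_zero_eq_constantCoeff_apply, coeff_linSubst_id,
      Finsupp.prod_zero_index, one_mul]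
  rw [hcoeff, kappa, map_mul, h1, linSubst_inv _ _ _ (by rw [h4]; simp) (by rw [h2, h3]; simp), h2]
  congr 1
  rw [eq_comm, MvPowerSeries.eq_mul_inv_iff_mul_eq (by rw [h3]; simp), kernelProd,
    ← Finset.prod_mul_distrib]
  refine Finset.prod_congr rfl fun j hj => ?_
  have h5 : (Finset.range n).filter (· < j) = Finset.range j := by
    ext i
    rw [Finset.mem_range] at hj
    simp only [Finset.mem_filter, Finset.mem_range]
    omega
  rw [h5, mul_assoc, ← Finset.prod_mul_distrib, Finset.prod_eq_one, mul_one, varFactor,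
    if_neg (by simp)]
  intro i _
  rw [pairFactor, if_pos rfl]
  exact MvPowerSeries.inv_mul_cancel _ (by simp)

theorem coeff_kappa {p : PowerSeries ℝ} (hp : p.constantCoeff = 1) {S : Finset ℕ} {d : ℕ →₀ ℕ}
    (hd : d.support ⊆ S) : coeff d (kappa p) = coeff d (kernelProd p (fun _ => false) S) := by
  have hS : S ⊆ Finset.range (S.sup id + 1) := fun i hi =>
    Finset.mem_range.mpr (Nat.lt_succ_iff.mpr (Finset.le_sup (f := id) hi))
  rw [coeff_kappa_range hp _ (hd.trans hS), coeff_kernelProd_of_subset hp _ hS hd]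

/-- The factor of a pair only depends on whether the kinds agree, so changing all kinds at once just
replaces `p` by `p*`. -/
theorem kernelProd_true {p : PowerSeries ℝ} (S : Finset ℕ) :
    kernelProd p (fun _ => true) S = kernelProd (dualSeries p) (fun _ => false) S := by
  simp [kernelProd, varFactor, pairFactor]

theorem coeff_mapDomain_swap_kappa {p : PowerSeries ℝ} (hp : p.constantCoeff = 1) (i j : ℕ)
    (d : ℕ →₀ ℕ) : coeff (d.mapDomain (Equiv.swap i j)) (kappa p) = coeff d (kappa p) := by
  rcases eq_or_ne i j with rfl | hij
  · rw [Equiv.swap_self]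
    congr 2
    exact Finsupp.mapDomain_id
  let S : Finset ℕ := (d.support.erase i).erase j
  have hi : i ∉ S := by simp [S]
  have hj : j ∉ S := by simp [S]
  have hi' : i ∉ insert j S := by simp [hij, hi]
  have hne : ∀ k ∈ S, k ≠ i ∧ k ≠ j := fun k hk => ⟨fun h => hi (h ▸ hk), fun h => hj (h ▸ hk)⟩
  have hd : d.support ⊆ insert i (insert j S) := by
    intro k hk
    simp only [S, Finset.mem_insert, Finset.mem_erase]
    tauto
  have hd' : (d.mapDomain (Equiv.swap i j)).support ⊆ insert i (insert j S) := by
    intro k hk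
    obtain ⟨l, hl, rfl⟩ := Finset.mem_image.mp (Finsupp.mapDomain_support hk)
    rcases Finset.mem_insert.mp (hd hl) with rfl | hl'
    · simp
    rcases Finset.mem_insert.mp hl' with rfl | hl'
    · simp
    rw [Equiv.swap_apply_of_ne_of_ne (hne l hl').1 (hne l hl').2]
    exact hd hl
  rw [coeff_kappa hp hd, coeff_kappa hp hd', 
    ← coeff_linSubst_perm (Equiv.swap i j) (kernelProd _ _ _) d]
  congr 1
  rw [kernelProd_insert _ _ hi', kernelProd_insert _ _ hj, Finset.prod_insert hj]
  simp only [map_mul, map_prod, linSubst_varFactor, linSubst_pairFactor, Pi.one_apply, one_smul,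
    Equiv.swap_apply_left, Equiv.swap_apply_right]
  have h1 : ∀ l, ∏ k ∈ S, pairFactor false false (X l * X (Equiv.swap i j k)) =
      ∏ k ∈ S, pairFactor false false (X l * X k) := fun l =>
    Finset.prod_congr rfl fun k hk => by
      rw [Equiv.swap_apply_of_ne_of_ne (hne k hk).1 (hne k hk).2]
  rw [linSubst_kernelProd (Equiv.swap i j) 1 _ _
    (fun k hk => Equiv.swap_apply_of_ne_of_ne (hne k hk).1 (hne k hk).2) (fun _ _ => rfl), h1, h1,
    mul_comm (X j : Series) (X i)]
  ring

/-- With `x_0` as the only variable there are no pairs, and `κ_p` reduces to `p(x_0)`. -/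
theorem kappa_injective {p q : PowerSeries ℝ} (hp : p.constantCoeff = 1)
    (hq : q.constantCoeff = 1) (h : kappa p = kappa q) : p = q := by
  have key : ∀ {p : PowerSeries ℝ}, p.constantCoeff = 1 → ∀ n,
      coeff (Finsupp.single 0 n) (kappa p) = PowerSeries.coeff n p := by
    intro p hp n
    rw [coeff_kappa_range hp 1, kernelProd, Finset.prod_range_one, Finset.prod_eq_one, mul_one,
      varFactor, if_neg (by simp), PowerSeries.coeff_subst_single]
    · simp
    · simp
    · intro i hi
      obtain rfl : i = 0 := by
        by_contra h0
        simp [Ne.symm h0] at hi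
      simp
  ext n
  rw [← key hp, h, key hq]

/-! ### The image of `κ_p` under `ω` -/

theorem chainCount_insert_of_eq_zero (L M : List ℕ) (τ : ℕ → Bool) {e : ℕ → ℕ} {k : ℕ}
    (h : e k = 0) : chainCount (L ++ k :: M) τ e = chainCount (L ++ M) τ e := by
  induction L with
  | nil => rw [List.nil_append, List.nil_append, chainCount_cons, h, addStrip_zero]
  | cons i L ih => rw [List.cons_append, List.cons_append, chainCount_cons, chainCount_cons, ih]

/-- The combinatorial counterpart of `sum_coeff_kernelProd`. The strips for `k` and `k'` are added
consecutively, so they cancel by `sum_addStrip_addStrip`; the strips of `L` are added afterwards by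
linear operators. -/
theorem sum_chainCount {L M : List ℕ} {τ : ℕ → Bool} {k k' : ℕ} (hkk : k ≠ k')
    (hL : k ∉ L ∧ k' ∉ L) (hM : k ∉ M ∧ k' ∉ M) (hτ : τ k = true) (hτ' : τ k' = false)
    {e : ℕ →₀ ℕ} (he : e k = 0) (he' : e k' = 0) {n : ℕ} (hn : 0 < n) :
    ∑ j ∈ Finset.range (n + 1), (-1 : ℝ) ^ j • chainCount (L ++ k' :: k :: M) τ
      (e + Finsupp.single k j + Finsupp.single k' (n - j) : ℕ →₀ ℕ) = 0 := by
  have hoff : ∀ i, i ≠ k → i ≠ k' → ∀ j,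
      (e + Finsupp.single k j + Finsupp.single k' (n - j) : ℕ →₀ ℕ) i = e i := by
    intro i hi hi' j
    rw [Finsupp.add_apply, Finsupp.add_apply, Finsupp.single_eq_of_ne hi,
      Finsupp.single_eq_of_ne hi', add_zero, add_zero]
  induction L with
  | nil =>
    rw [← sum_addStrip_addStrip (chainCount M τ e) hn]
    refine Finset.sum_congr rfl fun j _ => ?_
    have h1 : chainCount M τ (e + Finsupp.single k j + Finsupp.single k' (n - j) : ℕ →₀ ℕ) =
        chainCount M τ e := chainCount_congr fun i hi => by
      rw [hoff i (fun h => hM.1 (h ▸ hi)) (fun h => hM.2 (h ▸ hi))]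
    rw [List.nil_append, chainCount_cons, chainCount_cons, h1, hτ, hτ']
    simp [he, he', hkk, hkk.symm]
  | cons i L ih =>
    simp only [List.mem_cons, not_or] at hL
    have ih := ih ⟨hL.1.2, hL.2.2⟩
    simp only [List.cons_append, chainCount_cons, hoff i (Ne.symm hL.1.1) (Ne.symm hL.2.1)]
    rw [← addStrip_sum, ih]
    funext ν
    exact Finset.sum_const_zero

/-- Outer induction on the number of dual variables, inner induction on the exponent of one of them,
`k`. Without dual variables the claim is the Schur expansion of `κ_p`. -/
theorem sum_chainCount_eq_coeff_kernelProd {p : PowerSeries ℝ} (hp : p.constantCoeff = 1)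
    {c : YoungDiagram → ℝ} (hc : HasSchurExpansion (kappa p) c) {L : List ℕ} (hL : L.Nodup)
    (τ : ℕ → Bool) {e : ℕ →₀ ℕ} (he : ∀ i ∈ e.support, i ∈ L) :
    ∑ lam ∈ diagrams e.degree, c lam * chainCount L τ e lam =
      coeff e (kernelProd p τ L.toFinset) := by
  induction hm : (L.toFinset.filter fun i => τ i = true).card generalizing L τ e with
  | zero =>
    have hτ : ∀ i ∈ L, τ i = false := by
      intro i hi
      rw [Finset.card_eq_zero, Finset.filter_eq_empty_iff] at hm
      simpa using hm (List.mem_toFinset.mpr hi)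
    rw [kernelProd_congr p (τ' := fun _ => false) fun i hi => hτ i (List.mem_toFinset.mp hi),
      ← coeff_kappa hp fun i hi => List.mem_toFinset.mpr (he i hi), hc.coeff_eq]
    refine Finset.sum_congr rfl fun lam _ => ?_
    rw [kostka_eq_chainCount hL he, chainCount_congr fun i hi => by rw [hτ i hi]]
  | succ m ihm =>
    have hpos : 0 < (L.toFinset.filter fun i => τ i = true).card := by omega
    obtain ⟨k, hk⟩ := Finset.card_pos.mp hpos
    clear hpos
    rw [Finset.mem_filter, List.mem_toFinset] at hk
    obtain ⟨hkL, hτ⟩ := hk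
    induction hn : e k using Nat.strong_induction_on generalizing L τ e with
    | _ n ihn =>
    -- A variable with exponent zero may change its kind on both sides, which lowers the number of
    -- dual variables.
    rcases Nat.eq_zero_or_pos n with rfl | hpos
    · have h1 : chainCount L τ e = chainCount L (Function.update τ k false) e := by
        refine chainCount_congr fun i _ => ?_
        by_cases hi : i = k
        · subst hi
          rw [hn]
          funext g
          rw [addStrip_zero, addStrip_zero]
        · rw [Function.update_of_ne hi]
      have h2 : coeff e (kernelProd p τ L.toFinset) =
          coeff e (kernelProd p (Function.update τ k false) L.toFinset) := by
        rw [← Finset.insert_erase (List.mem_toFinset.mpr hkL), coeff_kernelProd_insert hp _ _ hn,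
          coeff_kernelProd_insert hp _ _ hn]
        congr 1
        refine kernelProd_congr p fun i hi => ?_
        rw [Function.update_of_ne (Finset.ne_of_mem_erase hi)]
      rw [h1, h2]
      refine ihm hL _ he ?_
      have h3 : (L.toFinset.filter fun i => Function.update τ k false i = true) =
          (L.toFinset.filter fun i => τ i = true).erase k := by
        ext i
        by_cases hi : i = k
        · subst hi
          simp
        · simp [hi]
      rw [h3, Finset.card_erase_of_mem
        (Finset.mem_filter.mpr ⟨List.mem_toFinset.mpr hkL, hτ⟩), hm, Nat.add_sub_cancel]
    -- Introduce a fresh ordinary variable `k'`, placed next to `k`, and spread the exponent `n` of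
    -- `k` over both as `j` and `n - j`. The number of dual variables stays the same, so the inner
    -- induction applies for `j < n`.
    · obtain ⟨k', hk'⟩ := Infinite.exists_notMem_finset L.toFinset
      rw [List.mem_toFinset] at hk'
      have hkk : k ≠ k' := fun h => hk' (h ▸ hkL)
      obtain ⟨L₁, L₂, rfl⟩ := List.mem_iff_append.mp hkL
      let τ' := Function.update τ k' false
      let L' := L₁ ++ k' :: k :: L₂
      have hperm : L'.Perm (k' :: (L₁ ++ k :: L₂)) := List.perm_middle
      have hL' : L'.Nodup := hperm.nodup_iff.mpr (List.nodup_cons.mpr ⟨hk', hL⟩)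
      have hmem : ∀ i, i ∈ L' ↔ i = k' ∨ i ∈ L₁ ++ k :: L₂ := fun i => by
        rw [hperm.mem_iff, List.mem_cons]
      have hfin : L'.toFinset = insert k' (L₁ ++ k :: L₂).toFinset := by
        ext i
        rw [List.mem_toFinset, hmem, Finset.mem_insert, List.mem_toFinset]
      have hk'e : e k' = 0 := Finsupp.notMem_support_iff.mp fun h => hk' (he _ h)
      have hk₁ : k ∉ L₁ := fun h => List.disjoint_of_nodup_append hL h List.mem_cons_self
      have hk₂ : k ∉ L₂ := (List.nodup_cons.mp (List.Nodup.of_append_right hL)).1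
      have hk'₁ : k' ∉ L₁ := fun h => hk' (List.mem_append_left _ h)
      have hk'₂ : k' ∉ L₂ := fun h =>
        hk' (List.mem_append_right _ (List.mem_cons_of_mem _ h))
      have hτ'L : ∀ i ∈ L₁ ++ k :: L₂, τ' i = τ i := fun i hi =>
        Function.update_of_ne (fun h : i = k' => hk' (h ▸ hi)) _ _
      have hτ'k : τ' k = true := by rw [hτ'L k hkL, hτ]
      have hτ'k' : τ' k' = false := Function.update_self _ _ _
      let E : ℕ → ℕ →₀ ℕ := fun j => e.erase k + Finsupp.single k j + Finsupp.single k' (n - j)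
      have hEn : E n = e := by
        change e.erase k + Finsupp.single k n + Finsupp.single k' (n - n) = e
        rw [Nat.sub_self, Finsupp.single_zero, add_zero, ← hn, Finsupp.erase_add_single]
      have hdeg : ∀ j ∈ Finset.range (n + 1), (E j).degree = e.degree := by
        intro j hj
        rw [← hEn]
        rw [Finset.mem_range] at hj
        simp only [E, map_add, Finsupp.degree_single]
        omega
      have hsupp : ∀ j, ∀ i ∈ (E j).support, i ∈ L' := by
        intro j i hi
        rw [hmem]
        by_contra! h
        have hik : i ≠ k := fun h' => h.2 (h' ▸ hkL)
        have hie : e i = 0 := Finsupp.notMem_support_iff.mp fun h' => h.2 (he i h')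
        rw [Finsupp.mem_support_iff] at hi
        simp [E, Finsupp.erase_ne hik, hie, Finsupp.single_eq_of_ne hik,
          Finsupp.single_eq_of_ne h.1] at hi
      have hm' : (L'.toFinset.filter fun i => τ' i = true).card = m + 1 := by
        rw [← hm, hfin, Finset.filter_insert, if_neg (by simp [hτ'k'])]
        congr 1
        refine Finset.filter_congr fun i hi => ?_
        rw [hτ'L i (List.mem_toFinset.mp hi)]
      have hA : ∑ j ∈ Finset.range (n + 1), (-1 : ℝ) ^ j *
          ∑ lam ∈ diagrams e.degree, c lam * chainCount L' τ' (E j) lam = 0 := by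
        have h1 := sum_chainCount hkk ⟨hk₁, hk'₁⟩ ⟨hk₂, hk'₂⟩ hτ'k hτ'k'
          (e := e.erase k) Finsupp.erase_same (by rw [Finsupp.erase_ne hkk.symm, hk'e]) hpos
        simp only [Finset.mul_sum]
        rw [Finset.sum_comm]
        refine Finset.sum_eq_zero fun lam _ => ?_
        have h2 := congrFun h1 lam
        simp only [Finset.sum_apply, Pi.smul_apply, smul_eq_mul, Pi.zero_apply] at h2
        rw [← mul_zero (c lam), ← h2, Finset.mul_sum]
        exact Finset.sum_congr rfl fun j _ => by ring
      have hB : ∑ j ∈ Finset.range (n + 1), (-1 : ℝ) ^ j *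
          coeff (E j) (kernelProd p τ' L'.toFinset) = 0 := by
        have h1 := sum_coeff_kernelProd hp (τ := τ') (S := (L₁ ++ L₂).toFinset) hkk
          (by simp [hk₁, hk₂]) (by simp [hk'₁, hk'₂]) hτ'k hτ'k'
          (e := e.erase k) Finsupp.erase_same (by rw [Finsupp.erase_ne hkk.symm, hk'e]) hpos
        have h2 : insert k (insert k' (L₁ ++ L₂).toFinset) = L'.toFinset := by
          ext i
          simp only [hfin, Finset.mem_insert, List.mem_toFinset, List.mem_append, List.mem_cons]
          tauto
        rwa [h2] at h1
      have hlt : ∀ j ∈ Finset.range n, (-1 : ℝ) ^ j *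
          (∑ lam ∈ diagrams e.degree, c lam * chainCount L' τ' (E j) lam) =
            (-1 : ℝ) ^ j * coeff (E j) (kernelProd p τ' L'.toFinset) := by
        intro j hj
        have hj' := Finset.mem_range.mp hj
        rw [← hdeg j (Finset.mem_range.mpr (by omega)),
          ihn j hj' hL' τ' (hsupp j) hm' ((hmem k).mpr (Or.inr hkL)) hτ'k (by simp [E, hkk])]
      -- Both alternating sums vanish and agree in the terms `j < n`, so they agree in the term `j =
      -- n`. There `k'` has exponent zero and can be dropped again.
      rw [Finset.sum_range_succ, hEn] at hA hB
      rw [Finset.sum_congr rfl hlt] at hA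
      have hAB := mul_left_cancel₀ (pow_ne_zero n (by norm_num : (-1 : ℝ) ≠ 0))
        (add_left_cancel (hA.trans hB.symm))
      rw [chainCount_insert_of_eq_zero _ _ _ hk'e, hfin, coeff_kernelProd_insert hp _ _ hk'e,
        chainCount_congr fun i hi => by rw [hτ'L i hi],
        kernelProd_congr p fun i hi => hτ'L i (List.mem_toFinset.mp hi)] at hAB
      exact hAB

/-! ### Duality and its consequences -/

theorem exists_hasSchurExpansion_kappa {p : PowerSeries ℝ} (hp : p.constantCoeff = 1) :
    ∃ c, HasSchurExpansion (kappa p) c :=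
  exists_hasSchurExpansion (coeff_mapDomain_swap_kappa hp)

/-- Take all variables dual: transposition turns chains of vertical strips into chains of horizontal
ones, that is, into Kostka numbers of the transposed shape. -/
theorem omega_kappa {p : PowerSeries ℝ} (hp : p.constantCoeff = 1) :
    omega (kappa p) = kappa (dualSeries p) := by
  obtain ⟨c, hc⟩ := exists_hasSchurExpansion_kappa hp
  ext d
  have hnd := Finset.nodup_toList d.support
  have hmem : ∀ i ∈ d.support, i ∈ d.support.toList := fun i hi => Finset.mem_toList.mpr hi
  rw [hc.omega.coeff_eq, coeff_kappa (constantCoeff_dualSeries hp) (S := d.support) subset_rfl,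
    ← kernelProd_true]
  have h := sum_chainCount_eq_coeff_kernelProd hp hc hnd (fun _ => true) hmem
  rw [Finset.toList_toFinset] at h
  rw [← h]
  refine Finset.sum_bij' (fun lam _ => lam.transpose) (fun lam _ => lam.transpose) ?_ ?_ ?_ ?_ ?_
  · intro lam hlam
    rwa [mem_diagrams, card_transpose, ← mem_diagrams]
  · intro lam hlam
    rwa [mem_diagrams, card_transpose, ← mem_diagrams]
  · simp
  · simp
  · intro lam _
    rw [kostka_eq_chainCount hnd hmem, chainCount_transpose, YoungDiagram.transpose_transpose]

theorem kappaPositive_dualSeries {p : PowerSeries ℝ} (hp : p.constantCoeff = 1)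
    (h : KappaPositive p) : KappaPositive (dualSeries p) := by
  obtain ⟨c, hc, hpos⟩ := h
  have := hc.omega
  rw [omega_kappa hp] at this
  exact ⟨_, this, fun lam => hpos lam.transpose⟩

theorem isDual_iff {p q : PowerSeries ℝ} (hp : p.constantCoeff = 1) (hq : q.constantCoeff = 1) :
    IsDual p q ↔ q = dualSeries p := by
  rw [IsDual, omega_kappa hq]
  constructor
  · intro h
    rw [kappa_injective hp (constantCoeff_dualSeries hq) h, dualSeries_dualSeries hq]
  · rintro rfl
    rw [dualSeries_dualSeries hp]

theorem dualSeries_one : dualSeries 1 = (1 - PowerSeries.X ^ 2)⁻¹ := by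
  rw [dualSeries, map_one, mul_one]

theorem dualSeries_geometric :
    dualSeries (1 - PowerSeries.X)⁻¹ = (1 - PowerSeries.X)⁻¹ := by
  have h1 : (1 - PowerSeries.X : PowerSeries ℝ)⁻¹ * (1 - PowerSeries.X) = 1 :=
    PowerSeries.inv_mul_cancel _ (by simp)
  have h2 := congrArg (PowerSeries.rescale (-1)) h1
  rw [map_mul, map_sub, map_one, PowerSeries.rescale_X, map_neg, map_one, neg_one_mul] at h2
  refine (eq_dualSeries_of_mul (by simp) ?_).symm
  -- Here `p(-x) = 1/(1 + x)`; the factors `1 + x` and `1 - x` of `1 - x²` cancel it and the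
  -- candidate `1/(1 - x)`.
  linear_combination h2 + (1 + PowerSeries.X) *
    PowerSeries.rescale (-1) (1 - PowerSeries.X : PowerSeries ℝ)⁻¹ * h1

end KappaPositivity

open KappaPositivity in
theorem mainTheorem3 :
    (∀ p : PowerSeries ℝ, p.constantCoeff = 1 →
      -- `p ↦ 1 / ((1 - x²) p(-x))` is an involution of the series with constant term `1`
      (KappaPositivity.dualSeries p).constantCoeff = 1 ∧
      KappaPositivity.dualSeries (KappaPositivity.dualSeries p) = p ∧
      -- it preserves `κ`-positivity
      (KappaPositivity.KappaPositive p →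
        KappaPositivity.KappaPositive (KappaPositivity.dualSeries p)) ∧
      -- it corresponds to applying `ω` to `κ_p`
      KappaPositivity.kappa p ∈ KappaPositivity.completedSymmetricFunctions ∧
      KappaPositivity.omega (KappaPositivity.kappa p) =
        KappaPositivity.kappa (KappaPositivity.dualSeries p) ∧
      -- it gives the only series that is dual to `p`
      (∀ q : PowerSeries ℝ, q.constantCoeff = 1 →
        (KappaPositivity.IsDual p q ↔ q = KappaPositivity.dualSeries p))) ∧
    -- the two special cases
    (KappaPositivity.dualSeries 1 = (1 - PowerSeries.X ^ 2)⁻¹ ∧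
      KappaPositivity.dualSeries (1 - PowerSeries.X ^ 2)⁻¹ = 1 ∧
      KappaPositivity.IsDual 1 (1 - PowerSeries.X ^ 2)⁻¹ ∧
      KappaPositivity.IsDual (1 - PowerSeries.X ^ 2)⁻¹ 1) ∧
    (KappaPositivity.dualSeries (1 - PowerSeries.X)⁻¹ = (1 - PowerSeries.X)⁻¹ ∧
      KappaPositivity.IsDual (1 - PowerSeries.X)⁻¹ (1 - PowerSeries.X)⁻¹) := by
  have h1 : (1 : PowerSeries ℝ).constantCoeff = 1 := map_one _
  have h2 : dualSeries (1 - PowerSeries.X ^ 2)⁻¹ = 1 := by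
    rw [← dualSeries_one, dualSeries_dualSeries h1]
  have h3 : ((1 - PowerSeries.X ^ 2)⁻¹ : PowerSeries ℝ).constantCoeff = 1 := by simp
  have h4 : ((1 - PowerSeries.X)⁻¹ : PowerSeries ℝ).constantCoeff = 1 := by simp
  exact ⟨fun p hp => ⟨constantCoeff_dualSeries hp, dualSeries_dualSeries hp,
      kappaPositive_dualSeries hp, exists_hasSchurExpansion_kappa hp, omega_kappa hp,
      fun q hq => isDual_iff hp hq⟩,
    ⟨dualSeries_one, h2, (isDual_iff h1 h3).mpr dualSeries_one.symm,
      (isDual_iff h3 h1).mpr h2.symm⟩,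
    dualSeries_geometric, (isDual_iff h4 h4).mpr dualSeries_geometric.symm⟩
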